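/- Let $\nu\in(0,1]$ and $h,\lambda>0$. Let $T_1,T_2,\dots$ be i.i.d. random variables having the generalized Mittag-Leffler density $$f_{\nu,h,\lambda}(t)=\lambda^h t^{\nu h-1}E^h_{\nu,\nu h}(-\lambda t^\nu)\,1_{(0,\infty)}(t),\qquad E^\gamma_{\alpha,\beta}(x)=\sum_{r\ge 0}\frac{(\gamma)_r\,x^r}{r!\,\Gamma(\alpha r+\beta)},$$ where $(\gamma)_0=1$ and $(\gamma)_r=\gamma(\gamma+1)\cdots(\gamma+r-1)$ for $r\ge1$. Let $M_{\nu,h,\lambda}(t)=\sum_{n\ge1}1_{\{T_1+\cdots+T_n\le t\}}$ be the associated renewal counting process, and put $$\kappa_{\nu,h,\lambda}(\theta)=\log\mathbb{E}[e^{\theta T_1}]\in(-\infty,\infty],\qquad I^{(T)}_{\nu,h,\lambda}(x)=\sup_{\theta\in\mathbb{R}}\{\theta x-\kappa_{\nu,h,\lambda}(\theta)\}.$$ Then, almost surely, $M_{\nu,h,\lambda}(t)<\infty$ for all $t$, and the family $\{M_{\nu,h,\lambda}(t)/t:t>0\}$ of real random variables satisfies the large deviation principle (with speed $t$, as $t\to\infty$)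 with the good rate function $$I^{(M)}_{\nu,h,\lambda}(x)=\begin{cases}x\,I^{(T)}_{\nu,h,\lambda}(1/x)&\text{if }x>0,\\ \lambda\,1_{\nu=1}&\text{if }x=0,\\ \infty&\text{if }x<0.\end{cases}$$ That is: $I^{(M)}_{\nu,h,\lambda}:\mathbb{R}\to[0,\infty]$ is lower semicontinuous, its level sets $\{I^{(M)}_{\nu,h,\lambda}\le\eta\}$, $0\le\eta<\infty$, are compact, and $$\limsup_{t\to\infty}\tfrac1t\log P\big(M_{\nu,h,\lambda}(t)/t\in C\big)\le-\inf_{x\in C}I^{(M)}_{\nu,h,\lambda}(x),\qquad \liminf_{t\to\infty}\tfrac1t\log P\big(M_{\nu,h,\lambda}(t)/t\in G\big)\ge-\inf_{x\in G}I^{(M)}_{\nu,h,\lambda}(x)$$ for all closed $C\subseteq\mathbb{R}$ and all open $G\subseteq\mathbb{R}$. Moreover, for $\nu=1$ (with $0\log0=0$), $$I^{(M)}_{1,h,\lambda}(x)=\begin{cases}hx\log\frac{hx}{\lambda}-hx+\lambda&\text{if }x\ge0,\\ \infty&\text{if }x<0,\end{cases}$$ and for $\nu\in(0,1)$: $I^{(M)}_{\nu,h,\lambda}(x)=\infty$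 for $x<0$; $I^{(M)}_{\nu,h,\lambda}$ is (strictly) increasing on $[0,\infty)$; $\lim_{x\downarrow0}I^{(M)}_{\nu,h,\lambda}(x)=I^{(M)}_{\nu,h,\lambda}(0)=0$; and $\lim_{x\to\infty}I^{(M)}_{\nu,h,\lambda}(x)=\infty$. -/

import Mathlib

open Filter Topology MeasureTheory ProbabilityTheory
open scoped ENNReal

noncomputable section

namespace FracPoisson

/-- `I` is a rate function: `[0, ∞]`-valued and lower semicontinuous. -/
def IsRateFunction {Z : Type*} [TopologicalSpace Z] (I : Z → EReal) : Prop :=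
  (∀ x, 0 ≤ I x) ∧ LowerSemicontinuous I

/-- A rate function is good if all its level sets `{I ≤ η}`, `0 ≤ η < ∞`, are compact. -/
def IsGoodRateFunction {Z : Type*} [TopologicalSpace Z] (I : Z → EReal) : Prop :=
  IsRateFunction I ∧ ∀ η : ℝ, 0 ≤ η → IsCompact {x | I x ≤ (η : EReal)}

/-- The family `(X t)` of random variables satisfies the large deviation principle (with speed `t`,
as `t → ∞`) with rate function `I`. Here `ENNReal.log 0 = -∞`, and infima over the empty set
are `+∞`. -/
def SatisfiesLDP {Ω : Type*} [MeasurableSpace Ω] {Z : Type*} [TopologicalSpace Z]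
    (P : Measure Ω) (X : ℝ → Ω → Z) (I : Z → EReal) : Prop :=
  IsRateFunction I ∧
  (∀ C : Set Z, IsClosed C →
    limsup (fun t : ℝ => ((1 / t : ℝ) : EReal) * ENNReal.log (P {ω | X t ω ∈ C})) atTop
      ≤ -(⨅ x ∈ C, I x)) ∧
  (∀ G : Set Z, IsOpen G →
    -(⨅ x ∈ G, I x) ≤
      liminf (fun t : ℝ => ((1 / t : ℝ) : EReal) * ENNReal.log (P {ω | X t ω ∈ G})) atTop)

/-- The generalized Mittag-Leffler function
`E_{α,β}^γ(x) = ∑_{r ≥ 0} (γ)_r x^r / (r! Γ(α r + β))`. -/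
def genMittagLeffler (α β γ x : ℝ) : ℝ :=
  ∑' r : ℕ, (ascPochhammer ℝ r).eval γ * x ^ r / ((r.factorial : ℝ) * Real.Gamma (α * r + β))

/-- The density `λ^h t^(ν h - 1) E_{ν,νh}^h(-λ t^ν) 1_{(0,∞)}(t)` of the generalized
Mittag-Leffler distribution. -/
def holdingDensity (ν h lam t : ℝ) : ℝ :=
  if 0 < t then
    lam ^ h * t ^ (ν * h - 1) * genMittagLeffler ν (ν * h) h (-lam * t ^ ν)
  else 0

/-- The generalized Mittag-Leffler distribution on `ℝ`. -/
def holdingLaw (ν h lam : ℝ) : Measure ℝ :=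
  volume.withDensity (fun t => ENNReal.ofReal (holdingDensity ν h lam t))

/-- The logarithmic moment generating function `κ(θ) = log E[exp (θ T₁)] ∈ (-∞, ∞]`. -/
def cumulant (ν h lam θ : ℝ) : EReal :=
  ENNReal.log (∫⁻ t, ENNReal.ofReal (Real.exp (θ * t)) ∂(holdingLaw ν h lam))

/-- The rate function `I^(T)(x) = sup_θ (θ x - κ(θ))` of the empirical means of holding times. -/
def rateT (ν h lam x : ℝ) : EReal :=
  ⨆ θ : ℝ, ((θ * x : ℝ) : EReal) - cumulant ν h lam θ

/-- The rate function `I^(M)` of the normalized counting process. -/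
def rateM (ν h lam x : ℝ) : EReal :=
  if 0 < x then (x : EReal) * rateT ν h lam (1 / x)
  else if x = 0 then (if ν = 1 then (lam : EReal) else 0)
  else ⊤

/-- The renewal counting process `∑_{n ≥ 1} 1_{T₁ + ⋯ + Tₙ ≤ t}`, with values in `[0, ∞]`; the
holding time `T₁` is `T 0`, `T₂` is `T 1`, and so on. -/
def countingProcess {Ω : Type*} (T : ℕ → Ω → ℝ) (t : ℝ) (ω : Ω) : ℝ≥0∞ :=
  ∑' n : ℕ, if ∑ k ∈ Finset.range (n + 1), T k ω ≤ t then 1 else 0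

end FracPoisson

end

/-! ### Laplace transform of the holding law -/

namespace FracPoisson

/-! The holding law has Laplace transform `(lam / (lam + s ^ ν)) ^ h`, so its cumulant `κ` is
explicit. For large `s` this is termwise integration and the binomial series. Nonnegativity of the
density is not available beforehand, so the negative part is treated as a measure: its transform
continues analytically to the half line, Landau's theorem makes it finite there, and total mass one
of the law forces it to vanish (`laplace_holdingLaw`). The cumulant is infinite exactly outside
`cgfDomain`: below order one, a finite exponential moment would give a finite mean, contradicting
the behaviour `s ^ ν` of the transform at 0.

Hence the rate function on `[0, ∞)` is the supremum over the domain of the affine functions `x ↦ θ -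
x κ(θ)`, and its analytic properties follow. For `x > 0` the supremum is attained at an interior
point, where `κ' = 1 / x` (`exists_maximizer`).

Probability enters through inversion: at least `n` renewals occur by time `t` exactly when `S_n ≤
t`. The upper bound is Chernoff's inequality on either side of the zero of the rate function. For
the lower bound, tilting by the maximizer gives the holding times mean `1 / x`, which makes about `x
t` renewals by time `t` typical (`one_le_tilted`, `eventually_le_measure`). The point `x = 0` is
reached by continuity from the right. -/

lemma hasSum_ascPochhammer_mul_pow (h : ℝ) {u : ℝ} (hu : |u| < 1) :
    HasSum (fun r : ℕ => (ascPochhammer ℝ r).eval h * u ^ r / (r.factorial : ℝ))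
      ((1 - u) ^ (-h)) := by
  have H := (Real.one_add_rpow_hasFPowerSeriesOnBall_zero (a := -h)).hasSum
    (y := -u) (by simpa [enorm_eq_nnnorm, ← NNReal.coe_lt_one] using hu)
  have key : ∀ r : ℕ, binomialSeries ℝ (-h) r (fun _ => -u) =
      (ascPochhammer ℝ r).eval h * u ^ r / (r.factorial : ℝ) := by
    intro r
    have h1 : (r.factorial : ℝ) * Ring.multichoose h r = (ascPochhammer ℝ r).eval h := by
      rw [← nsmul_eq_mul, Ring.factorial_nsmul_multichoose_eq_ascPochhammer,
        Polynomial.ascPochhammer_smeval_eq_eval]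
    have h2 : ((-1 : ℝ)) ^ r * (-1) ^ r = 1 := by rw [← mul_pow]; simp
    rw [binomialSeries_apply, Ring.choose_neg', ← h1]
    have hf : (r.factorial : ℝ) ≠ 0 := by positivity
    have h3 : Int.negOnePow (r : ℤ) • Ring.multichoose h r = (-1) ^ r * Ring.multichoose h r := by
      rw [Int.negOnePow_def, Units.smul_def]
      simp
    rw [h3]
    simp only [List.ofFn_const, List.prod_replicate, smul_eq_mul]
    rw [neg_pow u]
    field_simp
    linear_combination (Ring.multichoose h r * u ^ r) * h2
  simpa only [key, zero_sub, ← sub_eq_add_neg] using H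

lemma ascPochhammer_eval_eq_Gamma_div {h : ℝ} (hh : 0 < h) (r : ℕ) :
    (ascPochhammer ℝ r).eval h = Real.Gamma (r + h) / Real.Gamma h := by
  have hG := (Real.Gamma_pos_of_pos hh).ne'
  induction r with
  | zero => simp [hG]
  | succ r ih =>
    rw [ascPochhammer_succ_eval, ih]
    have : (r : ℝ) + h ≠ 0 := by positivity
    have e : ((r + 1 : ℕ) : ℝ) + h = (r + h) + 1 := by push_cast; ring
    rw [e, Real.Gamma_add_one this]
    field_simp
    ring

lemma ascPochhammer_eval_nonneg {h : ℝ} (hh : 0 < h) (r : ℕ) :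
    0 ≤ (ascPochhammer ℝ r).eval h := (ascPochhammer_pos r h hh).le

lemma integrableOn_rpow_mul_exp_neg_mul {a r : ℝ} (ha : 0 < a) (hr : 0 < r) :
    IntegrableOn (fun t : ℝ => t ^ (a - 1) * Real.exp (-(r * t))) (Set.Ioi 0) := by
  -- A non-integrable function has integral 0 by convention, so a nonzero value of the integral
  -- proves integrability.
  refine not_imp_comm.1 integral_undef ?_
  rw [Real.integral_rpow_mul_exp_neg_mul_Ioi ha hr]
  have := Real.Gamma_pos_of_pos ha
  positivity

/-- The Laplace transform of the (signed) generalized Mittag-Leffler density, for large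
arguments. -/
lemma laplace_holdingDensity_of_large {ν h lam s : ℝ} (hν : 0 < ν) (hh : 0 < h) (hlam : 0 < lam)
    (hs : 0 < s) (hsl : lam < s ^ ν) :
    Integrable (fun t => Real.exp (-s * t) * holdingDensity ν h lam t) ∧
    ∫ t, Real.exp (-s * t) * holdingDensity ν h lam t = (lam / (lam + s ^ ν)) ^ h := by
  set F : ℕ → ℝ → ℝ := fun r t =>
    (lam ^ h * ((ascPochhammer ℝ r).eval h * (-lam) ^ r /
      ((r.factorial : ℝ) * Real.Gamma (ν * r + ν * h)))) *
      (t ^ (ν * r + ν * h - 1) * Real.exp (-(s * t))) with hF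
  have hsν : 0 < s ^ ν := Real.rpow_pos_of_pos hs _
  have hpos : ∀ r : ℕ, 0 < ν * r + ν * h := fun r => by positivity
  have hint : ∀ r, Integrable (F r) (volume.restrict (Set.Ioi 0)) := fun r =>
    (integrableOn_rpow_mul_exp_neg_mul (hpos r) hs).const_mul _
  have hpow : ∀ r : ℕ, (1 / s) ^ (ν * r + ν * h) = (1 / s ^ ν) ^ h * (1 / s ^ ν) ^ r := by
    intro r
    have e : (1 / s ^ ν) = (1 / s) ^ ν := by rw [Real.div_rpow zero_le_one hs.le, Real.one_rpow]
    rw [e, ← Real.rpow_natCast, ← Real.rpow_mul (by positivity), ← Real.rpow_mul (by positivity),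
      ← Real.rpow_add (by positivity), add_comm]
  have hG : ∀ r : ℕ, Real.Gamma (ν * r + ν * h) ≠ 0 := fun r => (Real.Gamma_pos_of_pos (hpos r)).ne'
  have hval : ∀ r, ∫ t in Set.Ioi 0, F r t = (lam / s ^ ν) ^ h *
      ((ascPochhammer ℝ r).eval h * (-lam / s ^ ν) ^ r / (r.factorial : ℝ)) := by
    intro r
    simp only [hF]
    rw [integral_const_mul, Real.integral_rpow_mul_exp_neg_mul_Ioi (hpos r) hs, hpow,
      Real.div_rpow hlam.le hsν.le, Real.div_rpow zero_le_one hsν.le, Real.one_rpow, div_pow,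
      div_pow]
    have := hG r
    field_simp
    simp
  have hnorm : ∀ r, ∫ t in Set.Ioi 0, ‖F r t‖ = (lam / s ^ ν) ^ h *
      ((ascPochhammer ℝ r).eval h * (lam / s ^ ν) ^ r / (r.factorial : ℝ)) := by
    intro r
    have e : ∀ t ∈ Set.Ioi (0 : ℝ), ‖F r t‖ = (lam ^ h * ((ascPochhammer ℝ r).eval h * lam ^ r /
      ((r.factorial : ℝ) * Real.Gamma (ν * r + ν * h)))) *
      (t ^ (ν * r + ν * h - 1) * Real.exp (-(s * t))) := by
      intro t ht
      have ht' : 0 < t := ht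
      simp only [hF, norm_mul, norm_div, norm_pow, Real.norm_eq_abs, abs_neg]
      rw [abs_of_pos hlam, abs_of_nonneg (ascPochhammer_eval_nonneg hh r),
        abs_of_pos (Real.Gamma_pos_of_pos (hpos r)), abs_of_pos (Real.rpow_pos_of_pos hlam h),
        abs_of_pos (Real.rpow_pos_of_pos ht' _), abs_of_pos (Real.exp_pos _), Nat.abs_cast]
    rw [setIntegral_congr_fun measurableSet_Ioi e, integral_const_mul,
      Real.integral_rpow_mul_exp_neg_mul_Ioi (hpos r) hs, hpow,
      Real.div_rpow hlam.le hsν.le, Real.div_rpow zero_le_one hsν.le, Real.one_rpow, div_pow,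
      div_pow]
    have := hG r
    field_simp
    simp
  have hlt : lam / s ^ ν < 1 := (div_lt_one hsν).2 hsl
  -- The norms sum to a binomial series at `lam / s ^ ν < 1`; this is what permits exchanging sum
  -- and integral, and why `s` must be large.
  have hsum : Summable fun r => ∫ t in Set.Ioi 0, ‖F r t‖ := by
    simp only [hnorm]
    exact ((hasSum_ascPochhammer_mul_pow h (u := lam / s ^ ν)
      (by rwa [abs_of_pos (by positivity)])).summable).mul_left _
  have H := hasSum_integral_of_summable_integral_norm hint hsum
  have H2 : HasSum (fun r => ∫ t in Set.Ioi 0, F r t)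
      ((lam / s ^ ν) ^ h * (1 - (-lam / s ^ ν)) ^ (-h)) := by
    simp only [hval]
    exact (hasSum_ascPochhammer_mul_pow h
      (by rwa [neg_div, abs_neg, abs_of_pos (by positivity)])).mul_left _
  have H3 := H.unique H2
  have htsum : ∀ t, (Set.Ioi (0 : ℝ)).indicator (fun t => ∑' r, F r t) t =
      Real.exp (-s * t) * holdingDensity ν h lam t := by
    intro t
    by_cases ht : 0 < t
    · rw [Set.indicator_of_mem (Set.mem_Ioi.2 ht), holdingDensity, if_pos ht, genMittagLeffler,
        ← tsum_mul_left, ← tsum_mul_left]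
      refine tsum_congr fun r => ?_
      simp only [hF]
      rw [show ν * r + ν * h - 1 = (ν * h - 1) + ν * r by ring, Real.rpow_add ht,
        Real.rpow_mul ht.le, Real.rpow_natCast, mul_pow, neg_mul s t]
      ring
    · rw [Set.indicator_of_notMem (by simpa using ht), holdingDensity, if_neg ht, mul_zero]
  have hintegral : ∫ t, Real.exp (-s * t) * holdingDensity ν h lam t =
      (lam / (lam + s ^ ν)) ^ h := by
    simp only [← htsum]
    rw [integral_indicator measurableSet_Ioi, H3]
    have e : 1 - (-lam / s ^ ν) = (lam + s ^ ν) / s ^ ν := by field_simp; ring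
    rw [e, Real.rpow_neg (by positivity), Real.div_rpow hlam.le hsν.le,
      Real.div_rpow (by positivity) hsν.le, Real.div_rpow hlam.le (by positivity)]
    have := Real.rpow_pos_of_pos hsν h
    have := Real.rpow_pos_of_pos (add_pos hlam hsν) h
    field_simp
  refine ⟨not_imp_comm.1 integral_undef ?_, hintegral⟩
  rw [hintegral]
  positivity

/-- Multiplying by `exp (-s t)` with `s` large makes the density integrable, hence a.e. measurable,
and the factor can be undone. -/
lemma aemeasurable_holdingDensity {ν h lam : ℝ} (hν : 0 < ν) (hh : 0 < h) (hlam : 0 < lam) :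
    AEMeasurable (holdingDensity ν h lam) := by
  obtain ⟨s, hs, hsl⟩ : ∃ s : ℝ, 0 < s ∧ lam < s ^ ν :=
    ((eventually_gt_atTop 0).and ((tendsto_rpow_atTop hν).eventually_gt_atTop lam)).exists
  have H := (laplace_holdingDensity_of_large hν hh hlam hs hsl).1.aemeasurable
  have : holdingDensity ν h lam =
      fun t => Real.exp (s * t) * (Real.exp (-s * t) * holdingDensity ν h lam t) := by
    ext t
    rw [← mul_assoc, ← Real.exp_add]
    simp
  rw [this]
  exact (by fun_prop : Measurable fun t : ℝ => Real.exp (s * t)).aemeasurable.mul H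

lemma integrable_exp_mul_mono {m : Measure ℝ} (hm : ∀ᵐ x ∂m, 0 ≤ x) {a b : ℝ} (hab : a ≤ b)
    (hb : Integrable (fun x => Real.exp (b * x)) m) :
    Integrable (fun x => Real.exp (a * x)) m := by
  refine hb.mono' (by fun_prop) ?_
  filter_upwards [hm] with x hx
  rw [Real.norm_eq_abs, Real.abs_exp]
  gcongr

/-- A measure `m` on `[0, ∞)` whose Laplace transform coincides near infinity with a function that
is analytic on the whole half line has a finite Laplace transform on the whole half line
(Landau). -/
lemma mem_integrableExpSet_of_analyticOnNhd {m : Measure ℝ} (hm : ∀ᵐ x ∂m, 0 ≤ x) {H : ℝ → ℝ}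
    (hH : AnalyticOnNhd ℝ H (Set.Iio 0)) {t₀ : ℝ}
    (hint : ∀ t < t₀, t ∈ integrableExpSet id m) (heq : ∀ t < t₀, mgf id m t = H t)
    {t : ℝ} (ht : t < 0) :
    t ∈ integrableExpSet id m ∧ mgf id m t = H t := by
  have hid : ∀ τ ≤ 0, Set.Iio τ ⊆ integrableExpSet id m → Set.EqOn (mgf id m) H (Set.Iio τ) := by
    intro τ hτ hsub
    have h1 : AnalyticOnNhd ℝ (mgf id m) (Set.Iio τ) :=
      analyticOnNhd_mgf.mono (interior_maximal hsub isOpen_Iio)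
    have h2 : AnalyticOnNhd ℝ H (Set.Iio τ) := hH.mono (Set.Iio_subset_Iio hτ)
    refine h1.eqOn_of_preconnected_of_eventuallyEq h2 isPreconnected_Iio
      (z₀ := min t₀ τ - 1) (by simp only [Set.mem_Iio]; linarith [min_le_right t₀ τ]) ?_
    filter_upwards [Iio_mem_nhds (show min t₀ τ - 1 < t₀ by linarith [min_le_left t₀ τ])] with u hu
    exact heq u hu
  suffices hE : Set.Iio 0 ⊆ integrableExpSet id m from ⟨hE ht, hid 0 le_rfl hE ht⟩
  by_contra hcon
  obtain ⟨t₁, ht₁, ht₁E⟩ := Set.not_subset.1 hcon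
  rw [Set.mem_Iio] at ht₁
  set E := integrableExpSet id m with hEdef
  have hdown : ∀ a b, a ≤ b → b ∈ E → a ∈ E := fun a b hab hb => integrable_exp_mul_mono hm hab hb
  have hbdd : ∀ a ∈ E, a ≤ t₁ := fun a ha => by
    by_contra hlt
    exact ht₁E (hdown _ _ (not_le.1 hlt).le ha)
  have hbddE : BddAbove E := ⟨t₁, hbdd⟩
  have hne : E.Nonempty := ⟨t₀ - 1, hint _ (by linarith)⟩
  set τ := sSup E with hτ
  have hτ0 : τ < 0 := (csSup_le hne hbdd).trans_lt ht₁
  have hsub : Set.Iio τ ⊆ E := by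
    intro a ha
    obtain ⟨b, hb, hab⟩ := exists_lt_of_lt_csSup hne ha
    exact hdown _ _ hab.le hb
  have hEq := hid τ hτ0.le hsub
  -- Suppose the abscissa `τ` is negative. The power series of `H` at `τ` is recentred at `τ - ρ /
  -- 4`, where radius at least `3 ρ / 4` remains, and evaluated `ρ / 2` further right, that is at `τ
  -- + ρ / 4`, beyond the abscissa.
  obtain ⟨p, r, hp⟩ := hH τ hτ0
  obtain ⟨ρ, hρ0, hρ⟩ : ∃ ρ : ℝ, 0 < ρ ∧ ENNReal.ofReal ρ ≤ r := by
    obtain ⟨q, hq0, hq⟩ := ENNReal.lt_iff_exists_nnreal_btwn.1 hp.r_pos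
    refine ⟨q, by exact_mod_cast hq0, ?_⟩
    rw [ENNReal.ofReal_coe_nnreal]
    exact hq.le
  have hyn : ((‖(-(ρ / 4))‖₊ : NNReal) : ℝ≥0∞) = ENNReal.ofReal (ρ / 4) := by
    rw [← enorm_eq_nnnorm, Real.enorm_eq_ofReal_abs, abs_neg, abs_of_pos (by positivity)]
  have hp' := hp.changeOrigin (y := -(ρ / 4)) (by
    rw [hyn]
    exact lt_of_lt_of_le ((ENNReal.ofReal_lt_ofReal_iff hρ0).2 (by linarith)) hρ)
  have hS := hp'.hasSum_iteratedFDeriv (y := ρ / 2) (by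
    rw [Metric.mem_eball, edist_zero_right, hyn, Real.enorm_eq_ofReal_abs,
      abs_of_pos (by positivity)]
    refine lt_of_lt_of_le ?_ (tsub_le_tsub_right hρ _)
    rw [← ENNReal.ofReal_sub _ (by positivity)]
    exact (ENNReal.ofReal_lt_ofReal_iff (by linarith)).2 (by linarith))
  set s := τ + -(ρ / 4) with hs
  have hsτ : s < τ := by linarith
  have hsint : s ∈ interior E := interior_maximal hsub isOpen_Iio hsτ
  set G : ℕ → ℝ → ℝ := fun n x =>
    ((n.factorial : ℝ)⁻¹ * (ρ / 2) ^ n) * (x ^ n * Real.exp (s * x)) with hG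
  have hterm : ∀ n : ℕ, ((n.factorial : ℝ)⁻¹ • iteratedFDeriv ℝ n H s fun _ => ρ / 2) =
      ∫ x, G n x ∂m := by
    intro n
    have h1 : H =ᶠ[𝓝 s] mgf id m := by
      filter_upwards [Iio_mem_nhds hsτ] with u hu using (hEq hu).symm
    have h2 : iteratedDeriv n H s = ∫ x, x ^ n * Real.exp (s * x) ∂m := by
      rw [h1.iteratedDeriv_eq n, iteratedDeriv_mgf hsint n]
      rfl
    rw [iteratedFDeriv_apply_eq_iteratedDeriv_mul_prod, h2]
    simp only [hG, integral_const_mul, Finset.prod_const, Finset.card_univ, Fintype.card_fin,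
      smul_eq_mul]
    ring
  have hGint : ∀ n, Integrable (G n) m := fun n =>
    (integrable_pow_mul_exp_of_mem_interior_integrableExpSet hsint n).const_mul _
  have hGnn : ∀ n, 0 ≤ᵐ[m] G n := by
    intro n
    filter_upwards [hm] with x hx
    simp only [hG, Pi.zero_apply]
    positivity
  simp only [hterm] at hS
  -- The Taylor coefficients at `s` are moments of `m` and all terms are nonnegative, so Tonelli
  -- turns convergence of the series into a finite exponential moment past `τ`.
  have hmem : s + ρ / 2 ∈ E := by
    refine ⟨by fun_prop, ?_⟩
    rw [hasFiniteIntegral_iff_ofReal (ae_of_all _ fun x => (Real.exp_pos _).le)]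
    have e : ∀ᵐ x ∂m, ENNReal.ofReal (Real.exp ((s + ρ / 2) * id x)) =
        ∑' n, ENNReal.ofReal (G n x) := by
      filter_upwards [hm] with x hx
      have h1 : HasSum (fun n => G n x) (Real.exp (ρ / 2 * x) * Real.exp (s * x)) := by
        have := (NormedSpace.expSeries_div_hasSum_exp (𝔸 := ℝ) (ρ / 2 * x)).mul_right
          (Real.exp (s * x))
        rw [← Real.exp_eq_exp_ℝ] at this
        refine this.congr_fun fun n => ?_
        simp only [hG, mul_pow]
        ring
      rw [← ENNReal.ofReal_tsum_of_nonneg _ h1.summable, h1.tsum_eq, ← Real.exp_add, id]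
      · ring_nf
      · intro n
        simp only [hG]
        positivity
    rw [lintegral_congr_ae e, lintegral_tsum fun n => (hGint n).aemeasurable.ennreal_ofReal]
    simp only [← ofReal_integral_eq_lintegral_ofReal (hGint _) (hGnn _)]
    rw [← ENNReal.ofReal_tsum_of_nonneg (fun n => integral_nonneg_of_ae (hGnn n)) hS.summable]
    exact ENNReal.ofReal_lt_top
  have := le_csSup hbddE hmem
  linarith

/-- The closed form of the cumulant generating function of the holding times on its domain. -/
noncomputable def holdingCGF (ν h lam θ : ℝ) : ℝ := -(h * Real.log ((lam + (-θ) ^ ν) / lam))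

/-- The set of the arguments where the cumulant of the holding times is finite. -/
def cgfDomain (ν lam : ℝ) : Set ℝ := if ν = 1 then Set.Iio lam else Set.Iic 0

lemma exp_holdingCGF {ν h lam θ : ℝ} (hlam : 0 < lam) (hθ : 0 < lam + (-θ) ^ ν) :
    Real.exp (holdingCGF ν h lam θ) = (lam / (lam + (-θ) ^ ν)) ^ h := by
  rw [Real.rpow_def_of_pos (by positivity), holdingCGF, ← inv_div, Real.log_inv]
  ring_nf

lemma analyticAt_rpow_const {g : ℝ → ℝ} {x : ℝ} (c : ℝ) (hg : AnalyticAt ℝ g x) (hx : 0 < g x) :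
    AnalyticAt ℝ (fun y => g y ^ c) x := by
  refine ((hg.log hx).mul (analyticAt_const (v := c))).rexp'.congr ?_
  filter_upwards [hg.continuousAt.eventually_const_lt hx] with y hy
  rw [Real.rpow_def_of_pos hy, Pi.mul_apply]

lemma holdingDensity_of_nonpos (ν h lam : ℝ) {t : ℝ} (ht : t ≤ 0) : holdingDensity ν h lam t = 0 :=
  if_neg ht.not_gt

lemma ae_pos_withDensity_of_eq_zero {g : ℝ → ℝ≥0∞} (hg : AEMeasurable g)
    (h0 : ∀ t ≤ 0, g t = 0) : ∀ᵐ x ∂(volume.withDensity g), 0 < x := by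
  rw [ae_withDensity_iff' hg]
  exact ae_of_all _ fun x hx => by
    by_contra hlt
    exact hx (h0 x (not_lt.1 hlt))

lemma ae_pos_holdingLaw {ν h lam : ℝ} (hν : 0 < ν) (hh : 0 < h) (hlam : 0 < lam) :
    ∀ᵐ x ∂(holdingLaw ν h lam), 0 < x :=
  ae_pos_withDensity_of_eq_zero (aemeasurable_holdingDensity hν hh hlam).ennreal_ofReal
    fun t ht => by rw [holdingDensity_of_nonpos ν h lam ht, ENNReal.ofReal_zero]

lemma integrable_withDensity_ofReal {f g : ℝ → ℝ} (hf : AEMeasurable f)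
    (hg : Measurable g) (hfg : Integrable fun t => g t * f t) :
    Integrable g (volume.withDensity fun t => ENNReal.ofReal (f t)) ∧
      ∫ t, g t ∂(volume.withDensity fun t => ENNReal.ofReal (f t)) = ∫ t, g t * max (f t) 0 := by
  have hlt : ∀ᵐ t : ℝ, ENNReal.ofReal (f t) < ∞ := ae_of_all _ fun _ => ENNReal.ofReal_lt_top
  constructor
  · rw [integrable_withDensity_iff_integrable_smul₀' hf.ennreal_ofReal hlt]
    refine hfg.mono ((hf.ennreal_ofReal.ennreal_toReal.smul hg.aemeasurable).aestronglyMeasurable)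
      (ae_of_all _ fun t => ?_)
    rw [norm_smul, norm_mul, mul_comm, ENNReal.toReal_ofReal', Real.norm_eq_abs (max _ _),
      abs_of_nonneg (le_max_right _ _)]
    gcongr
    exact max_le (Real.le_norm_self _) (norm_nonneg _)
  · rw [integral_withDensity_eq_integral_toReal_smul₀ hf.ennreal_ofReal hlt]
    simp only [ENNReal.toReal_ofReal', smul_eq_mul, mul_comm]

/-- The Laplace transform of the generalized Mittag-Leffler distribution. -/
lemma laplace_holdingLaw {ν h lam : ℝ} (hν : 0 < ν) (hh : 0 < h) (hlam : 0 < lam)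
    [IsProbabilityMeasure (holdingLaw ν h lam)] {θ : ℝ} (hθ : θ < 0) :
    ∫ x, Real.exp (θ * x) ∂(holdingLaw ν h lam) = (lam / (lam + (-θ) ^ ν)) ^ h := by
  have hf := aemeasurable_holdingDensity hν hh hlam
  set f := holdingDensity ν h lam with hfdef
  set μ := holdingLaw ν h lam with hμ
  -- `holdingLaw` keeps only the positive part of `f`; the transform of the negative part `m` is the
  -- error to be shown zero.
  set m := volume.withDensity (fun t => ENNReal.ofReal (-f t)) with hm
  set F : ℝ → ℝ := fun θ => (lam / (lam + (-θ) ^ ν)) ^ h with hF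
  have hμ0 : ∀ᵐ x ∂μ, 0 ≤ x := (ae_pos_holdingLaw hν hh hlam).mono fun _ => le_of_lt
  have hm0 : ∀ᵐ x ∂m, 0 ≤ x :=
    (ae_pos_withDensity_of_eq_zero hf.neg.ennreal_ofReal fun t ht => by
      simp [hfdef, holdingDensity_of_nonpos ν h lam ht]).mono fun _ => le_of_lt
  have hμint : ∀ θ ≤ 0, Integrable (fun x => Real.exp (θ * x)) μ := fun θ hθ =>
    integrable_exp_mul_mono hμ0 hθ (by simp)
  have hμan : AnalyticOnNhd ℝ (mgf id μ) (Set.Iio 0) :=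
    analyticOnNhd_mgf.mono (interior_maximal (fun θ hθ => hμint θ (le_of_lt hθ)) isOpen_Iio)
  have hFan : AnalyticOnNhd ℝ F (Set.Iio 0) := by
    intro θ hθ
    have hθ' : 0 < -θ := neg_pos.2 hθ
    have h0 : 0 < (-θ) ^ ν := Real.rpow_pos_of_pos hθ' _
    have h1 : AnalyticAt ℝ (fun θ : ℝ => (-θ) ^ ν) θ :=
      analyticAt_rpow_const ν analyticAt_id.neg hθ'
    have h2 : 0 < lam + (-θ) ^ ν := by positivity
    exact analyticAt_rpow_const h (analyticAt_const.div (analyticAt_const.add h1) h2.ne')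
      (div_pos hlam h2)
  obtain ⟨s₀, hs₀⟩ : ∃ s₀ : ℝ, ∀ s ≥ s₀, 0 < s ∧ lam < s ^ ν :=
    eventually_atTop.1
      ((eventually_gt_atTop 0).and ((tendsto_rpow_atTop hν).eventually_gt_atTop lam))
  have hlarge : ∀ θ < -s₀, θ ∈ integrableExpSet id m ∧ mgf id m θ = mgf id μ θ - F θ := by
    intro θ hθ
    obtain ⟨hs, hsl⟩ := hs₀ (-θ) (by linarith)
    obtain ⟨hi, hv⟩ := laplace_holdingDensity_of_large hν hh hlam hs hsl
    rw [neg_neg] at hi hv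
    obtain ⟨-, hp⟩ := integrable_withDensity_ofReal hf (g := fun t => Real.exp (θ * t))
      (by fun_prop) hi
    obtain ⟨hni, hn⟩ := integrable_withDensity_ofReal hf.neg (g := fun t => Real.exp (θ * t))
      (by fun_prop) (by simpa using hi.neg)
    have hmeas : Measurable fun t => Real.exp (θ * t) := by fun_prop
    refine ⟨hni, ?_⟩
    have e1 : mgf id m θ = ∫ t, Real.exp (θ * t) * max (-f t) 0 := hn
    have e2 : mgf id μ θ = ∫ t, Real.exp (θ * t) * max (f t) 0 := hp
    have e3 : F θ = ∫ t, Real.exp (θ * t) * f t := hv.symm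
    have i1 : Integrable fun t => Real.exp (θ * t) * max (f t) 0 := by
      refine hi.mono (hmeas.aemeasurable.mul (hf.max aemeasurable_const)).aestronglyMeasurable
        (ae_of_all _ fun t => ?_)
      rw [norm_mul, norm_mul, Real.norm_eq_abs (max _ _), abs_of_nonneg (le_max_right _ _)]
      gcongr
      exact max_le (Real.le_norm_self _) (norm_nonneg _)
    rw [e1, e2, e3, ← integral_sub i1 hi]
    congr 1
    ext t
    rcases le_total 0 (f t) with h0 | h0
    · rw [max_eq_left h0, max_eq_right (by linarith)]; ring
    · rw [max_eq_right h0, max_eq_left (by linarith)]; ring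
  have hext : ∀ θ < 0, θ ∈ integrableExpSet id m ∧ mgf id m θ = mgf id μ θ - F θ := fun θ hθ =>
    mem_integrableExpSet_of_analyticOnNhd hm0 (hμan.sub hFan) (fun t ht => (hlarge t ht).1)
      (fun t ht => (hlarge t ht).2) hθ
  -- Here total mass one enters: the transform of `m` is nondecreasing in `θ` and that of `μ` is at
  -- most 1, while `F θ'` tends to 1 as `θ'` increases to 0.
  have hle : ∀ θ' ∈ Set.Ioo θ 0, mgf id m θ ≤ 1 - F θ' := by
    intro θ' hθ'
    have h1 : mgf id m θ ≤ mgf id m θ' := by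
      refine integral_mono_ae (hext θ hθ).1 (hext θ' hθ'.2).1 ?_
      filter_upwards [hm0] with x hx
      simp only [id]
      gcongr
      exact hθ'.1.le
    have h2 : mgf id μ θ' ≤ 1 := by
      have : mgf id μ θ' ≤ ∫ _, (1 : ℝ) ∂μ := by
        refine integral_mono_ae (hμint θ' hθ'.2.le) (integrable_const _) ?_
        filter_upwards [hμ0] with x hx
        simp only [id, Real.exp_le_one_iff]
        exact mul_nonpos_of_nonpos_of_nonneg hθ'.2.le hx
      simpa using this
    linarith [(hext θ' hθ'.2).2]
  have hF0 : Tendsto (fun θ' => 1 - F θ') (𝓝[<] 0) (𝓝 0) := by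
    have hc : ContinuousAt F 0 := by
      have h1 : ContinuousAt (fun θ : ℝ => (-θ) ^ ν) 0 :=
        continuousAt_neg.rpow_const (Or.inr hν.le)
      have h2 : lam + (-(0 : ℝ)) ^ ν ≠ 0 := by
        rw [neg_zero, Real.zero_rpow hν.ne', add_zero]; exact hlam.ne'
      exact (continuousAt_const.div (continuousAt_const.add h1) h2).rpow_const (Or.inr hh.le)
    have : Tendsto (fun θ' => 1 - F θ') (𝓝 0) (𝓝 (1 - F 0)) := tendsto_const_nhds.sub hc.tendsto
    have e : 1 - F 0 = 0 := by
      simp [hF, Real.zero_rpow hν.ne', hlam.ne']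
    rw [e] at this
    exact this.mono_left nhdsWithin_le_nhds
  have hzero : mgf id m θ ≤ 0 := by
    refine ge_of_tendsto hF0 ?_
    filter_upwards [Ioo_mem_nhdsLT hθ] with θ' hθ' using hle θ' hθ'
  have h1 : mgf id m θ = 0 := le_antisymm hzero mgf_nonneg
  have h2 := (hext θ hθ).2
  rw [h1] at h2
  exact (sub_eq_zero.1 h2.symm)

/-- The Pochhammer factor cancels `Γ(r + h)` up to `Γ(h)`, leaving the exponential series; so order
one is the Gamma law. -/
lemma genMittagLeffler_one {h : ℝ} (hh : 0 < h) (x : ℝ) :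
    genMittagLeffler 1 (1 * h) h x = Real.exp x / Real.Gamma h := by
  have H := (NormedSpace.expSeries_div_hasSum_exp (𝔸 := ℝ) x).div_const (Real.Gamma h)
  rw [← Real.exp_eq_exp_ℝ] at H
  rw [genMittagLeffler, ← H.tsum_eq]
  refine tsum_congr fun r => ?_
  have h1 := (Real.Gamma_pos_of_pos hh).ne'
  have h2 : Real.Gamma (r + h) ≠ 0 := (Real.Gamma_pos_of_pos (by positivity)).ne'
  rw [ascPochhammer_eval_eq_Gamma_div hh, one_mul, one_mul]
  field_simp

lemma holdingDensity_one {h lam t : ℝ} (hh : 0 < h) (ht : 0 < t) :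
    holdingDensity 1 h lam t = gammaPDFReal h lam t := by
  rw [holdingDensity, if_pos ht, genMittagLeffler_one hh, gammaPDFReal, if_pos ht.le, one_mul,
    Real.rpow_one, neg_mul]
  ring

lemma lintegral_exp_holdingLaw_one {h lam θ : ℝ} (hh : 0 < h) (hlam : 0 < lam) (hθ : θ < lam) :
    ∫⁻ x, ENNReal.ofReal (Real.exp (θ * x)) ∂(holdingLaw 1 h lam) =
      ENNReal.ofReal ((lam / (lam - θ)) ^ h) := by
  have hpos : 0 < lam - θ := sub_pos.2 hθ
  rw [holdingLaw, lintegral_withDensity_eq_lintegral_mul₀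
    (aemeasurable_holdingDensity one_pos hh hlam).ennreal_ofReal
    (by fun_prop : Measurable fun x => ENNReal.ofReal (Real.exp (θ * x))).aemeasurable]
  have e : ∀ᵐ x : ℝ, ((fun t => ENNReal.ofReal (holdingDensity 1 h lam t)) *
      fun x => ENNReal.ofReal (Real.exp (θ * x))) x =
      ENNReal.ofReal ((lam / (lam - θ)) ^ h) * gammaPDF h (lam - θ) x := by
    -- The origin is discarded because the two densities follow different conventions there.
    have h0 : ∀ᵐ x : ℝ, x ≠ 0 := by simp [ae_iff]
    filter_upwards [h0] with x hx
    rw [Pi.mul_apply]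
    rcases lt_or_gt_of_ne hx with hx | hx
    · rw [holdingDensity_of_nonpos _ _ _ hx.le, gammaPDF_of_neg hx]
      simp
    · rw [holdingDensity_one hh hx, gammaPDF, ← ENNReal.ofReal_mul (gammaPDFReal_nonneg hh hlam x),
        ← ENNReal.ofReal_mul (by positivity), gammaPDFReal, gammaPDFReal, if_pos hx.le, if_pos hx.le,
        Real.div_rpow hlam.le hpos.le,
        show -((lam - θ) * x) = -(lam * x) + θ * x by ring, Real.exp_add]
      have := (Real.rpow_pos_of_pos hpos h).ne'
      congr 1
      field_simp
  rw [lintegral_congr_ae e, lintegral_const_mul' _ _ ENNReal.ofReal_ne_top,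
    lintegral_gammaPDF_eq_one hh hpos, mul_one]

end FracPoisson

/-! ### The cumulant and its exact domain -/

namespace FracPoisson

variable {ν h lam : ℝ}

lemma add_neg_rpow_pos (hlam : 0 < lam) {θ : ℝ} (hθ : θ ∈ cgfDomain ν lam) :
    0 < lam + (-θ) ^ ν := by
  rw [cgfDomain] at hθ
  split_ifs at hθ with h1
  · rw [h1, Real.rpow_one]
    linarith [Set.mem_Iio.1 hθ]
  · have := Real.rpow_nonneg (neg_nonneg.2 (Set.mem_Iic.1 hθ)) ν
    linarith

lemma lintegral_exp_holdingLaw (hν0 : 0 < ν) (hh : 0 < h) (hlam : 0 < lam)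
    [IsProbabilityMeasure (holdingLaw ν h lam)] {θ : ℝ} (hθ : θ ∈ cgfDomain ν lam) :
    ∫⁻ x, ENNReal.ofReal (Real.exp (θ * x)) ∂(holdingLaw ν h lam) =
      ENNReal.ofReal (Real.exp (holdingCGF ν h lam θ)) := by
  rw [exp_holdingCGF hlam (add_neg_rpow_pos hlam hθ)]
  rw [cgfDomain] at hθ
  split_ifs at hθ with h1
  · subst h1
    rw [lintegral_exp_holdingLaw_one hh hlam hθ, Real.rpow_one, sub_eq_add_neg]
  · rcases (Set.mem_Iic.1 hθ).lt_or_eq with hlt | rfl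
    · rw [← laplace_holdingLaw hν0 hh hlam hlt, ofReal_integral_eq_lintegral_ofReal]
      · exact integrable_exp_mul_mono
          ((ae_pos_holdingLaw hν0 hh hlam).mono fun _ => le_of_lt) hlt.le (by simp)
      · exact ae_of_all _ fun _ => (Real.exp_pos _).le
    · simp [Real.zero_rpow hν0.ne', hlam.ne']

lemma lintegral_exp_mono {m : Measure ℝ} (hm : ∀ᵐ x ∂m, 0 < x) {a b : ℝ} (hab : a ≤ b) :
    ∫⁻ x, ENNReal.ofReal (Real.exp (a * x)) ∂m ≤ ∫⁻ x, ENNReal.ofReal (Real.exp (b * x)) ∂m := by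
  refine lintegral_mono_ae ?_
  filter_upwards [hm] with x hx
  gcongr

/-- By monotonicity the integral dominates its values at all `θ' < lam`, which blow up at `lam`. -/
lemma lintegral_exp_holdingLaw_one_eq_top (hh : 0 < h) (hlam : 0 < lam) {θ : ℝ} (hθ : lam ≤ θ) :
    ∫⁻ x, ENNReal.ofReal (Real.exp (θ * x)) ∂(holdingLaw 1 h lam) = ⊤ := by
  have hlim : Tendsto (fun θ' => ENNReal.ofReal ((lam / (lam - θ')) ^ h)) (𝓝[<] lam) (𝓝 ⊤) := by
    refine ENNReal.tendsto_ofReal_atTop.comp ((tendsto_rpow_atTop hh).comp ?_)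
    refine Tendsto.const_mul_atTop hlam (tendsto_inv_nhdsGT_zero.comp ?_)
    refine tendsto_nhdsWithin_iff.2 ⟨?_, ?_⟩
    · have : Tendsto (fun θ' => lam - θ') (𝓝 lam) (𝓝 (lam - lam)) :=
        tendsto_const_nhds.sub tendsto_id
      rw [sub_self] at this
      exact this.mono_left nhdsWithin_le_nhds
    · filter_upwards [self_mem_nhdsWithin] with θ' hθ'
      exact Set.mem_Ioi.2 (sub_pos.2 (Set.mem_Iio.1 hθ'))
  refine top_le_iff.1 (le_of_tendsto hlim ?_)
  filter_upwards [self_mem_nhdsWithin] with θ' hθ'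
  rw [← lintegral_exp_holdingLaw_one hh hlam hθ']
  exact lintegral_exp_mono (ae_pos_holdingLaw one_pos hh hlam) ((le_of_lt hθ').trans hθ)

/-- Otherwise the mean `M` would be finite and the transform `L` would satisfy `1 - L(s) ≤ s M`,
whereas `1 - L(s)` is of order `h s ^ ν / lam`. Dividing by `s ^ ν` and letting `s` tend to 0 gives
`h / lam ≤ 0`. -/
lemma lintegral_exp_holdingLaw_eq_top_of_pos (hν0 : 0 < ν) (hν1 : ν < 1) (hh : 0 < h)
    (hlam : 0 < lam) [IsProbabilityMeasure (holdingLaw ν h lam)] {θ : ℝ} (hθ : 0 < θ) :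
    ∫⁻ x, ENNReal.ofReal (Real.exp (θ * x)) ∂(holdingLaw ν h lam) = ⊤ := by
  by_contra hne
  set μ := holdingLaw ν h lam
  have hpos : ∀ᵐ x ∂μ, 0 < x := ae_pos_holdingLaw hν0 hh hlam
  have hint : Integrable (fun x => Real.exp (θ * x)) μ := by
    refine ⟨by fun_prop, ?_⟩
    rw [hasFiniteIntegral_iff_ofReal (ae_of_all _ fun x => (Real.exp_pos _).le)]
    exact lt_top_iff_ne_top.2 hne
  have hid : Integrable (fun x : ℝ => x) μ := by
    refine (hint.div_const θ).mono' (by fun_prop) ?_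
    filter_upwards [hpos] with x hx
    rw [Real.norm_eq_abs, abs_of_pos hx, le_div_iff₀ hθ]
    linarith [Real.add_one_le_exp (θ * x)]
  set M := ∫ x, x ∂μ
  have key : ∀ s > 0, h / lam ≤ M * s ^ (1 - ν) * (1 + (1 + h) * (s ^ ν / lam)) := by
    intro s hs
    have hsν : 0 < s ^ ν := Real.rpow_pos_of_pos hs _
    have hL := laplace_holdingLaw (h := h) hν0 hh hlam (neg_lt_zero.2 hs)
    rw [neg_neg] at hL
    set u := s ^ ν / lam with hu
    have hu0 : 0 < u := by positivity
    have h1 : 1 - s * M ≤ (lam / (lam + s ^ ν)) ^ h := by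
      rw [← hL, ← integral_const_mul]
      have : (1 : ℝ) = ∫ _, (1 : ℝ) ∂μ := by simp
      rw [this, ← integral_sub (integrable_const _) (hid.const_mul s)]
      refine integral_mono_ae ((integrable_const _).sub (hid.const_mul s))
        (integrable_exp_mul_mono (hpos.mono fun _ => le_of_lt) (by linarith) hint) ?_
      exact ae_of_all _ fun x => by
        have := Real.add_one_le_exp (-s * x)
        simp only
        linarith
    -- From `(1 + u) ^ h ≥ 1 + h log (1 + u)` and `log (1 + u) ≥ u / (1 + u)`.
    have h2 : (lam / (lam + s ^ ν)) ^ h ≤ 1 / (1 + h * (u / (1 + u))) := by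
      have e : lam / (lam + s ^ ν) = (1 + u)⁻¹ := by rw [hu]; field_simp
      rw [e, Real.inv_rpow (by positivity), one_div]
      gcongr
      rw [Real.rpow_def_of_pos (by positivity)]
      have h3 := Real.one_sub_inv_le_log_of_pos (show 0 < 1 + u by positivity)
      have h4 : 1 - (1 + u)⁻¹ = u / (1 + u) := by field_simp; ring
      rw [h4] at h3
      have h5 := Real.add_one_le_exp (Real.log (1 + u) * h)
      nlinarith
    have h3 : 1 - s * M ≤ 1 / (1 + h * (u / (1 + u))) := h1.trans h2
    have h4 : 1 / (1 + h * (u / (1 + u))) = 1 - h * u / (1 + (1 + h) * u) := by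
      field_simp
      ring
    rw [h4] at h3
    have h5 : h * u / (1 + (1 + h) * u) ≤ s * M := by linarith
    rw [div_le_iff₀ (by positivity)] at h5
    have h6 : s * M = (M * s ^ (1 - ν)) * s ^ ν := by
      rw [mul_assoc, ← Real.rpow_add hs, sub_add_cancel, Real.rpow_one, mul_comm]
    rw [h6, hu] at h5
    have h7 : s ^ ν * (h / lam) ≤ s ^ ν * (M * s ^ (1 - ν) * (1 + (1 + h) * (s ^ ν / lam))) := by
      calc s ^ ν * (h / lam) = h * (s ^ ν / lam) := by ring
        _ ≤ _ := h5
        _ = _ := by ring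
    exact le_of_mul_le_mul_left h7 hsν
  have hlim : Tendsto (fun s : ℝ => M * s ^ (1 - ν) * (1 + (1 + h) * (s ^ ν / lam))) (𝓝[>] 0)
      (𝓝 (M * 0 ^ (1 - ν) * (1 + (1 + h) * (0 ^ ν / lam)))) := by
    refine Tendsto.mono_left (ContinuousAt.tendsto (f := fun s : ℝ =>
      M * s ^ (1 - ν) * (1 + (1 + h) * (s ^ ν / lam))) ?_) nhdsWithin_le_nhds
    have c1 : ContinuousAt (fun s : ℝ => s ^ (1 - ν)) 0 :=
      continuousAt_id.rpow_const (Or.inr (by linarith))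
    have c2 : ContinuousAt (fun s : ℝ => s ^ ν) 0 := continuousAt_id.rpow_const (Or.inr hν0.le)
    exact (continuousAt_const.mul c1).mul
      (continuousAt_const.add (continuousAt_const.mul (c2.div_const _)))
  rw [Real.zero_rpow (by linarith : 1 - ν ≠ 0), mul_zero, zero_mul] at hlim
  have := ge_of_tendsto hlim (eventually_mem_nhdsWithin.mono fun s hs => key s hs)
  have : 0 < h / lam := by positivity
  linarith

lemma lintegral_exp_holdingLaw_eq_top (hν0 : 0 < ν) (hν1 : ν ≤ 1) (hh : 0 < h) (hlam : 0 < lam)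
    [IsProbabilityMeasure (holdingLaw ν h lam)] {θ : ℝ} (hθ : θ ∉ cgfDomain ν lam) :
    ∫⁻ x, ENNReal.ofReal (Real.exp (θ * x)) ∂(holdingLaw ν h lam) = ⊤ := by
  rw [cgfDomain] at hθ
  split_ifs at hθ with h1
  · subst h1
    exact lintegral_exp_holdingLaw_one_eq_top hh hlam (by simpa using hθ)
  · exact lintegral_exp_holdingLaw_eq_top_of_pos hν0 (lt_of_le_of_ne hν1 h1) hh hlam
      (by simpa using hθ)

lemma cumulant_of_mem (hν0 : 0 < ν) (hh : 0 < h) (hlam : 0 < lam)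
    [IsProbabilityMeasure (holdingLaw ν h lam)] {θ : ℝ} (hθ : θ ∈ cgfDomain ν lam) :
    cumulant ν h lam θ = (holdingCGF ν h lam θ : EReal) := by
  rw [cumulant, lintegral_exp_holdingLaw hν0 hh hlam hθ,
    ENNReal.log_ofReal_of_pos (Real.exp_pos _), Real.log_exp]

lemma cumulant_of_notMem (hν0 : 0 < ν) (hν1 : ν ≤ 1) (hh : 0 < h) (hlam : 0 < lam)
    [IsProbabilityMeasure (holdingLaw ν h lam)] {θ : ℝ} (hθ : θ ∉ cgfDomain ν lam) :
    cumulant ν h lam θ = ⊤ := by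
  rw [cumulant, lintegral_exp_holdingLaw_eq_top hν0 hν1 hh hlam hθ, ENNReal.log_top]

/-! ### The rate function as a supremum of affine functions -/

lemma rateM_of_neg {x : ℝ} (hx : x < 0) : rateM ν h lam x = ⊤ := by
  rw [rateM, if_neg hx.not_gt, if_neg hx.ne]

lemma rateM_zero : rateM ν h lam 0 = if ν = 1 then (lam : EReal) else 0 := by
  simp [rateM]

/-- The factor `x` clears the `1 / x` in the Legendre transform. At `x = 0` the prescribed value is
the supremum of the domain, so the same bound persists. -/
lemma le_rateM (hν0 : 0 < ν) (hh : 0 < h) (hlam : 0 < lam)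
    [IsProbabilityMeasure (holdingLaw ν h lam)] {θ x : ℝ} (hθ : θ ∈ cgfDomain ν lam)
    (hx : 0 ≤ x) : ((θ - x * holdingCGF ν h lam θ : ℝ) : EReal) ≤ rateM ν h lam x := by
  rcases hx.lt_or_eq with hx | rfl
  · have h1 : ((θ * (1 / x) - holdingCGF ν h lam θ : ℝ) : EReal) ≤ rateT ν h lam (1 / x) := by
      refine le_iSup_of_le θ ?_
      rw [cumulant_of_mem hν0 hh hlam hθ, EReal.coe_sub]
    rw [rateM, if_pos hx]
    calc ((θ - x * holdingCGF ν h lam θ : ℝ) : EReal)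
        = (x : EReal) * ((θ * (1 / x) - holdingCGF ν h lam θ : ℝ) : EReal) := by
          rw [← EReal.coe_mul]
          congr 1
          field_simp
      _ ≤ _ := by gcongr
  · rw [rateM_zero, zero_mul, sub_zero]
    rw [cgfDomain] at hθ
    split_ifs at hθ ⊢ with h1
    · exact_mod_cast (Set.mem_Iio.1 hθ).le
    · exact_mod_cast Set.mem_Iic.1 hθ

lemma rateM_le (hν0 : 0 < ν) (hν1 : ν ≤ 1) (hh : 0 < h) (hlam : 0 < lam)
    [IsProbabilityMeasure (holdingLaw ν h lam)] {x B : ℝ} (hx : 0 < x)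
    (hB : ∀ θ ∈ cgfDomain ν lam, θ - x * holdingCGF ν h lam θ ≤ B) : rateM ν h lam x ≤ B := by
  have h1 : rateT ν h lam (1 / x) ≤ ((B / x : ℝ) : EReal) := by
    refine iSup_le fun θ => ?_
    by_cases hθ : θ ∈ cgfDomain ν lam
    · rw [cumulant_of_mem hν0 hh hlam hθ, ← EReal.coe_sub]
      have := hB θ hθ
      rw [EReal.coe_le_coe_iff, le_div_iff₀ hx]
      calc _ = θ - x * holdingCGF ν h lam θ := by field_simp
        _ ≤ B := this
    · rw [cumulant_of_notMem hν0 hν1 hh hlam hθ]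
      simp
  rw [rateM, if_pos hx]
  calc (x : EReal) * rateT ν h lam (1 / x) ≤ (x : EReal) * ((B / x : ℝ) : EReal) := by gcongr
    _ = B := by
      rw [← EReal.coe_mul]
      congr 1
      field_simp

lemma rateM_eq_of_forall_le (hν0 : 0 < ν) (hν1 : ν ≤ 1) (hh : 0 < h) (hlam : 0 < lam)
    [IsProbabilityMeasure (holdingLaw ν h lam)] {x θ₀ : ℝ} (hx : 0 < x)
    (hθ₀ : θ₀ ∈ cgfDomain ν lam)
    (hB : ∀ θ ∈ cgfDomain ν lam,
      θ - x * holdingCGF ν h lam θ ≤ θ₀ - x * holdingCGF ν h lam θ₀) :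
    rateM ν h lam x = ((θ₀ - x * holdingCGF ν h lam θ₀ : ℝ) : EReal) :=
  le_antisymm (rateM_le hν0 hν1 hh hlam hx hB) (le_rateM hν0 hh hlam hθ₀ hx.le)

/-- This is `log y ≤ y - 1` at `y = (lam - θ) / (h x)`, with equality at `θ = lam - h x`. -/
lemma sub_holdingCGF_one_le (hh : 0 < h) (hlam : 0 < lam) {x θ : ℝ} (hx : 0 < x) (hθ : θ < lam) :
    θ - x * holdingCGF 1 h lam θ ≤
      (lam - h * x) - x * holdingCGF 1 h lam (lam - h * x) := by
  have h1 : 0 < lam - θ := sub_pos.2 hθ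
  have h2 : 0 < h * x := by positivity
  have e : Real.log ((lam - θ) / lam) - Real.log (h * x / lam) = Real.log ((lam - θ) / (h * x)) := by
    rw [← Real.log_div (by positivity) (by positivity)]
    congr 1
    field_simp
  have h3 := Real.log_le_sub_one_of_pos (show 0 < (lam - θ) / (h * x) by positivity)
  have h4 : h * x * Real.log ((lam - θ) / (h * x)) ≤ (lam - θ) - h * x := by
    calc _ ≤ h * x * ((lam - θ) / (h * x) - 1) := by gcongr
      _ = _ := by field_simp
  simp only [holdingCGF, Real.rpow_one]
  rw [show lam + -θ = lam - θ by ring, show lam + -(lam - h * x) = h * x by ring]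
  rw [← e] at h4
  linarith

lemma differentiableAt_holdingCGF (hlam : 0 < lam) {θ : ℝ} (hθ : θ ∈ cgfDomain ν lam)
    (h1 : ν = 1 ∨ θ ≠ 0) : DifferentiableAt ℝ (holdingCGF ν h lam) θ := by
  have hpos := add_neg_rpow_pos hlam hθ
  have hd : DifferentiableAt ℝ (fun θ : ℝ => (-θ) ^ ν) θ := by
    rcases h1 with rfl | h1
    · simp only [Real.rpow_one]
      fun_prop
    · exact differentiableAt_id.neg.rpow_const (Or.inl (by simpa using h1))
  have : DifferentiableAt ℝ (fun θ : ℝ => (lam + (-θ) ^ ν) / lam) θ :=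
    ((differentiableAt_const lam).add hd).div_const lam
  exact ((this.log (by positivity)).const_mul h).neg

lemma holdingCGF_zero (hν0 : 0 < ν) (hlam : 0 < lam) : holdingCGF ν h lam 0 = 0 := by
  simp [holdingCGF, Real.zero_rpow hν0.ne', hlam.ne']

/-- For small `s > 0`, the affine function `x ↦ -s - x κ(-s)` is positive at `x`. -/
lemma exists_pos_neg_sub_holdingCGF (hν0 : 0 < ν) (hν1 : ν < 1) (hh : 0 < h) (hlam : 0 < lam)
    {x : ℝ} (hx : 0 < x) : ∃ s > 0, 0 < -s - x * holdingCGF ν h lam (-s) := by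
  have hlim : Tendsto (fun s : ℝ => s ^ (1 - ν)) (𝓝[>] 0) (𝓝 0) := by
    have : ContinuousAt (fun s : ℝ => s ^ (1 - ν)) 0 :=
      continuousAt_id.rpow_const (Or.inr (by linarith))
    have h2 := this.tendsto
    simp only [Real.zero_rpow (by linarith : 1 - ν ≠ 0)] at h2
    exact h2.mono_left nhdsWithin_le_nhds
  -- For `s ≤ 1` the logarithm is at least `s ^ ν / (lam + 1)`, so the gain `x h s ^ ν / (lam + 1)`
  -- beats the loss `s` once `s ^ (1 - ν)` is below this constant.
  have hc : 0 < x * h / (lam + 1) := by positivity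
  obtain ⟨s, hs1, hs0⟩ := ((hlim.eventually_lt_const hc).and (Ioo_mem_nhdsGT one_pos)).exists
  refine ⟨s, hs0.1, ?_⟩
  have hs : 0 < s := hs0.1
  have hsν : 0 < s ^ ν := Real.rpow_pos_of_pos hs _
  have hsν1 : s ^ ν ≤ 1 := Real.rpow_le_one hs.le hs0.2.le hν0.le
  have h3 := Real.one_sub_inv_le_log_of_pos (show 0 < (lam + s ^ ν) / lam by positivity)
  have h4 : s ^ ν / (lam + 1) ≤ Real.log ((lam + s ^ ν) / lam) := by
    refine le_trans ?_ h3
    rw [inv_div, show 1 - lam / (lam + s ^ ν) = s ^ ν / (lam + s ^ ν) by field_simp; ring]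
    gcongr
  have h5 : s < x * h / (lam + 1) * s ^ ν := by
    calc s = s ^ (1 - ν) * s ^ ν := by
          rw [← Real.rpow_add hs, sub_add_cancel, Real.rpow_one]
      _ < _ := by gcongr
  have h6 : x * h * (s ^ ν / (lam + 1)) ≤ x * h * Real.log ((lam + s ^ ν) / lam) := by gcongr
  rw [holdingCGF, neg_neg]
  have : x * h / (lam + 1) * s ^ ν = x * h * (s ^ ν / (lam + 1)) := by ring
  linarith

lemma neg_holdingCGF_le (hlam : 0 < lam) (hh : 0 < h) {s : ℝ} (hs : 0 ≤ s) :
    -holdingCGF ν h lam (-s) ≤ h / lam * s ^ ν := by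
  have hsν : 0 ≤ s ^ ν := Real.rpow_nonneg hs _
  have h1 := Real.log_le_sub_one_of_pos (show 0 < (lam + s ^ ν) / lam by positivity)
  rw [holdingCGF, neg_neg, neg_neg]
  calc h * Real.log ((lam + s ^ ν) / lam) ≤ h * ((lam + s ^ ν) / lam - 1) := by gcongr
    _ = _ := by field_simp; ring

/-- The supremum defining the rate function at `x > 0` is attained, at an interior point of the
domain of the cumulant. -/
lemma exists_maximizer (hν0 : 0 < ν) (hν1 : ν ≤ 1) (hh : 0 < h) (hlam : 0 < lam) {x : ℝ}
    (hx : 0 < x) : ∃ θ₀, cgfDomain ν lam ∈ 𝓝 θ₀ ∧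
      (∀ θ ∈ cgfDomain ν lam, θ - x * holdingCGF ν h lam θ ≤ θ₀ - x * holdingCGF ν h lam θ₀) ∧
      (ν = 1 → θ₀ = lam - h * x) ∧ (ν < 1 → θ₀ < 0 ∧ 0 < θ₀ - x * holdingCGF ν h lam θ₀) := by
  rcases hν1.lt_or_eq with hν1 | rfl
  · have hD : cgfDomain ν lam = Set.Iic 0 := if_neg hν1.ne
    rw [hD]
    set g : ℝ → ℝ := fun θ => θ - x * holdingCGF ν h lam θ with hg
    obtain ⟨s₁, hs₁, hpos⟩ := exists_pos_neg_sub_holdingCGF hν0 hν1 hh hlam hx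
    -- Past `R` one has `x (h / lam) s ^ ν ≤ s`, which makes the objective nonpositive, while it is
    -- positive at `-s₁`. So a maximum over `[-R, 0]` is global.
    set R : ℝ := max s₁ ((x * (h / lam)) ^ (1 - ν)⁻¹) with hR
    have hcont : ContinuousOn g (Set.Icc (-R) 0) := by
      intro θ hθ
      have hmem : θ ∈ cgfDomain ν lam := by rw [hD]; exact hθ.2
      have hp := add_neg_rpow_pos hlam hmem
      have c1 : ContinuousAt (fun θ : ℝ => (-θ) ^ ν) θ :=
        continuousAt_neg.rpow_const (Or.inr hν0.le)
      have c2 : ContinuousAt (holdingCGF ν h lam) θ :=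
        (((continuousAt_const.add c1).div_const lam).log (by positivity)).const_mul h |>.neg
      exact (continuousAt_id.sub (c2.const_mul x)).continuousWithinAt
    obtain ⟨θ₀, hθ₀, hmax⟩ := isCompact_Icc.exists_isMaxOn
      (⟨-s₁, neg_le_neg (le_max_left _ _), by linarith⟩ : (Set.Icc (-R) 0).Nonempty) hcont
    have hg0 : g 0 = 0 := by simp [hg, holdingCGF_zero hν0 hlam]
    have hgpos : 0 < g θ₀ := hpos.trans_le
      (hmax (a := -s₁) ⟨neg_le_neg (le_max_left _ _), by linarith⟩)
    -- The objective vanishes at 0, so the positive maximum is not at the endpoint of the domain.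
    have hθneg : θ₀ < 0 := lt_of_le_of_ne hθ₀.2 fun he => by
      rw [he, hg0] at hgpos
      exact lt_irrefl _ hgpos
    refine ⟨θ₀, Iic_mem_nhds hθneg, fun θ hθ => ?_, fun he => absurd he hν1.ne,
      fun _ => ⟨hθneg, hgpos⟩⟩
    by_cases hθR : -R ≤ θ
    · exact hmax (a := θ) ⟨hθR, hθ⟩
    · refine le_trans ?_ hgpos.le
      obtain ⟨s, rfl⟩ : ∃ s, θ = -s := ⟨-θ, by ring⟩
      have hsR : R < s := by linarith
      have hs : 0 < s := (hs₁.trans_le (le_max_left _ _)).trans hsR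
      have h1 : x * (h / lam) ≤ s ^ (1 - ν) := by
        have := (le_max_right s₁ ((x * (h / lam)) ^ (1 - ν)⁻¹)).trans hsR.le
        calc x * (h / lam) = ((x * (h / lam)) ^ (1 - ν)⁻¹) ^ (1 - ν) := by
              rw [← Real.rpow_mul (by positivity), inv_mul_cancel₀ (by linarith), Real.rpow_one]
          _ ≤ _ := Real.rpow_le_rpow (by positivity) this (by linarith)
      have h2 := neg_holdingCGF_le (ν := ν) hlam hh hs.le
      have h3 : x * (h / lam) * s ^ ν ≤ s := by
        calc _ ≤ s ^ (1 - ν) * s ^ ν := by gcongr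
          _ = s := by rw [← Real.rpow_add hs, sub_add_cancel, Real.rpow_one]
      have h4 : x * -holdingCGF ν h lam (-s) ≤ x * (h / lam * s ^ ν) := by gcongr
      linarith
  · have hD : cgfDomain 1 lam = Set.Iio lam := if_pos rfl
    rw [hD]
    exact ⟨lam - h * x, Iio_mem_nhds (by have : 0 < h * x := by positivity
                                         linarith),
      fun θ hθ => sub_holdingCGF_one_le hh hlam hx hθ, fun _ => rfl, fun hlt => absurd hlt (lt_irrefl _)⟩

/-- Fermat's rule at an interior maximum. The value `1 / x` is the mean holding time under the
tilted law. -/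
lemma hasDerivAt_holdingCGF_of_maximizer (hlam : 0 < lam) {x θ₀ : ℝ} (hx : 0 < x)
    (hD : cgfDomain ν lam ∈ 𝓝 θ₀) (h1 : ν = 1 ∨ θ₀ ≠ 0)
    (hmax : ∀ θ ∈ cgfDomain ν lam,
      θ - x * holdingCGF ν h lam θ ≤ θ₀ - x * holdingCGF ν h lam θ₀) :
    HasDerivAt (holdingCGF ν h lam) (1 / x) θ₀ := by
  have hd := (differentiableAt_holdingCGF (h := h) hlam (mem_of_mem_nhds hD) h1).hasDerivAt
  have hd2 := (hasDerivAt_id θ₀).sub (hd.const_mul x)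
  have hloc : IsLocalMax (fun θ => θ - x * holdingCGF ν h lam θ) θ₀ := by
    filter_upwards [hD] with θ hθ using hmax θ hθ
  have h0 := hloc.hasDerivAt_eq_zero hd2
  have : deriv (holdingCGF ν h lam) θ₀ = 1 / x := by
    field_simp
    linarith
  rwa [this] at hd

lemma zero_mem_cgfDomain (hlam : 0 < lam) : (0 : ℝ) ∈ cgfDomain ν lam := by
  rw [cgfDomain]
  split_ifs
  · exact hlam
  · exact Set.mem_Iic.2 le_rfl

lemma neg_mem_cgfDomain (hlam : 0 < lam) {θ : ℝ} (hθ : θ < 0) : θ ∈ cgfDomain ν lam := by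
  rw [cgfDomain]
  split_ifs
  · exact hθ.trans hlam
  · exact hθ.le

lemma rateM_nonneg (hν0 : 0 < ν) (hh : 0 < h) (hlam : 0 < lam)
    [IsProbabilityMeasure (holdingLaw ν h lam)] (x : ℝ) : 0 ≤ rateM ν h lam x := by
  rcases lt_or_ge x 0 with hx | hx
  · rw [rateM_of_neg hx]; exact le_top
  · simpa [holdingCGF_zero hν0 hlam] using
      le_rateM hν0 hh hlam (zero_mem_cgfDomain (ν := ν) hlam) hx

lemma rateM_one (hh : 0 < h) (hlam : 0 < lam)
    [IsProbabilityMeasure (holdingLaw 1 h lam)] (x : ℝ) : rateM 1 h lam x =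
      if 0 ≤ x then ((h * x * Real.log (h * x / lam) - h * x + lam : ℝ) : EReal) else ⊤ := by
  split_ifs with hx
  · rcases hx.lt_or_eq with hx | rfl
    · have hmem : lam - h * x ∈ cgfDomain 1 lam := by
        rw [cgfDomain, if_pos rfl]
        have : 0 < h * x := by positivity
        exact Set.mem_Iio.2 (by linarith)
      rw [rateM_eq_of_forall_le one_pos le_rfl hh hlam hx hmem fun θ hθ =>
        sub_holdingCGF_one_le hh hlam hx (by rwa [cgfDomain, if_pos rfl] at hθ), holdingCGF,
        Real.rpow_one, show lam + -(lam - h * x) = h * x by ring]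
      congr 1
      ring
    · rw [rateM_zero, if_pos rfl]
      simp
  · exact rateM_of_neg (not_le.1 hx)

/-- The supremum formula in a form valid also at `x = 0`, where for order one the supremum is not
attained; lower semicontinuity follows from it. -/
lemma lt_rateM_iff (hν0 : 0 < ν) (hν1 : ν ≤ 1) (hh : 0 < h) (hlam : 0 < lam)
    [IsProbabilityMeasure (holdingLaw ν h lam)] {x : ℝ} (hx : 0 ≤ x) {y : EReal} :
    y < rateM ν h lam x ↔
      ∃ θ ∈ cgfDomain ν lam, y < ((θ - x * holdingCGF ν h lam θ : ℝ) : EReal) := by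
  refine ⟨fun hy => ?_, fun ⟨θ, hθ, hy⟩ => hy.trans_le (le_rateM hν0 hh hlam hθ hx)⟩
  rcases hx.lt_or_eq with hx | rfl
  · obtain ⟨θ₀, hD, hmax, -⟩ := exists_maximizer hν0 hν1 hh hlam hx
    rw [rateM_eq_of_forall_le hν0 hν1 hh hlam hx (mem_of_mem_nhds hD) hmax] at hy
    exact ⟨θ₀, mem_of_mem_nhds hD, hy⟩
  · simp only [zero_mul, sub_zero]
    rw [rateM_zero] at hy
    rw [cgfDomain]
    split_ifs at hy ⊢ with h1
    · obtain ⟨z, hz1, hz2⟩ := EReal.lt_iff_exists_real_btwn.1 hy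
      exact ⟨z, by exact_mod_cast hz2, hz1⟩
    · exact ⟨0, Set.mem_Iic.2 le_rfl, by simpa using hy⟩

lemma lowerSemicontinuous_rateM (hν0 : 0 < ν) (hν1 : ν ≤ 1) (hh : 0 < h) (hlam : 0 < lam)
    [IsProbabilityMeasure (holdingLaw ν h lam)] : LowerSemicontinuous (rateM ν h lam) := by
  intro x y hy
  rcases lt_or_ge x 0 with hx | hx
  · filter_upwards [Iio_mem_nhds hx] with z hz
    rw [rateM_of_neg hx] at hy
    rwa [rateM_of_neg hz]
  · obtain ⟨θ, hθ, hlt⟩ := (lt_rateM_iff hν0 hν1 hh hlam hx).1 hy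
    have hc : Continuous fun z : ℝ => ((θ - z * holdingCGF ν h lam θ : ℝ) : EReal) :=
      continuous_coe_real_ereal.comp (by fun_prop)
    filter_upwards [hc.continuousAt.eventually_const_lt hlt] with z hz
    rcases lt_or_ge z 0 with hz0 | hz0
    · rw [rateM_of_neg hz0]
      exact hz.trans_le le_top
    · exact (lt_rateM_iff hν0 hν1 hh hlam hz0).2 ⟨θ, hθ, hz⟩

lemma holdingCGF_neg_one_neg (hh : 0 < h) (hlam : 0 < lam) : holdingCGF ν h lam (-1) < 0 := by
  rw [holdingCGF, neg_neg, Real.one_rpow, neg_lt_zero]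
  exact mul_pos hh (Real.log_pos ((one_lt_div hlam).2 (by linarith)))

/-- The affine minorant at `θ = -1` has positive slope, which bounds the level sets. -/
lemma isGoodRateFunction_rateM (hν0 : 0 < ν) (hν1 : ν ≤ 1) (hh : 0 < h) (hlam : 0 < lam)
    [IsProbabilityMeasure (holdingLaw ν h lam)] : IsGoodRateFunction (rateM ν h lam) := by
  refine ⟨⟨rateM_nonneg hν0 hh hlam, lowerSemicontinuous_rateM hν0 hν1 hh hlam⟩, fun η hη => ?_⟩
  have hk := holdingCGF_neg_one_neg (ν := ν) hh hlam
  refine (isCompact_Icc (a := (0 : ℝ)) (b := (η + 1) / -holdingCGF ν h lam (-1))).of_isClosed_subset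
    ((lowerSemicontinuous_rateM hν0 hν1 hh hlam).isClosed_preimage (η : EReal)) fun x hx => ?_
  have hx' : rateM ν h lam x ≤ η := hx
  rcases lt_or_ge x 0 with hx0 | hx0
  · rw [rateM_of_neg hx0] at hx'
    simp at hx'
  · have h1 := (le_rateM hν0 hh hlam (neg_mem_cgfDomain (ν := ν) hlam neg_one_lt_zero) hx0).trans hx'
    rw [EReal.coe_le_coe_iff] at h1
    refine ⟨hx0, ?_⟩
    rw [le_div_iff₀ (by linarith)]
    linarith

/-- The affine function optimal at `x > 0` has positive slope, because its intercept `θ₀` is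
negative and its value at `x` positive; it still bounds the rate from below at `y`. -/
lemma strictMonoOn_rateM (hν0 : 0 < ν) (hν1 : ν < 1) (hh : 0 < h) (hlam : 0 < lam)
    [IsProbabilityMeasure (holdingLaw ν h lam)] :
    StrictMonoOn (rateM ν h lam) (Set.Ici 0) := by
  intro x hx y hy hxy
  rcases (Set.mem_Ici.1 hx).lt_or_eq with hx | rfl
  · obtain ⟨θ₀, hD, hmax, -, h2⟩ := exists_maximizer hν0 hν1.le hh hlam hx
    obtain ⟨hneg, hpos⟩ := h2 hν1
    rw [rateM_eq_of_forall_le hν0 hν1.le hh hlam hx (mem_of_mem_nhds hD) hmax]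
    refine lt_of_lt_of_le ?_ (le_rateM hν0 hh hlam (mem_of_mem_nhds hD) hy)
    rw [EReal.coe_lt_coe_iff]
    have : holdingCGF ν h lam θ₀ < 0 := by
      by_contra hc
      nlinarith
    nlinarith
  · obtain ⟨θ₀, hD, hmax, -, h2⟩ := exists_maximizer hν0 hν1.le hh hlam hxy
    rw [rateM_eq_of_forall_le hν0 hν1.le hh hlam hxy (mem_of_mem_nhds hD) hmax, rateM_zero,
      if_neg hν1.ne]
    exact_mod_cast (h2 hν1).2

/-- Since `s ^ ν ≤ 1 + s`, the objective at `-s` is at most `-s + x (h / lam) (1 + s)`, and the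
terms in `s` add up to something nonpositive. -/
lemma rateM_le_mul (hν0 : 0 < ν) (hν1 : ν < 1) (hh : 0 < h) (hlam : 0 < lam)
    [IsProbabilityMeasure (holdingLaw ν h lam)] {x : ℝ} (hx : 0 < x) (hx1 : x * (h / lam) ≤ 1) :
    rateM ν h lam x ≤ ((x * (h / lam) : ℝ) : EReal) := by
  refine rateM_le hν0 hν1.le hh hlam hx fun θ hθ => ?_
  rw [cgfDomain, if_neg hν1.ne, Set.mem_Iic] at hθ
  obtain ⟨s, rfl⟩ : ∃ s, θ = -s := ⟨-θ, by ring⟩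
  have hs : 0 ≤ s := by linarith
  have h2 := neg_holdingCGF_le (ν := ν) hlam hh hs
  have h3 : s ^ ν ≤ 1 + s := by
    rcases le_total s 1 with h1 | h1
    · linarith [Real.rpow_le_one hs h1 hν0.le]
    · have := Real.rpow_le_rpow_of_exponent_le h1 hν1.le
      rw [Real.rpow_one] at this
      linarith
  have h4 : x * -holdingCGF ν h lam (-s) ≤ x * (h / lam * (1 + s)) := by
    gcongr
    exact h2.trans (by gcongr)
  nlinarith

lemma tendsto_rateM_zero (hν0 : 0 < ν) (hν1 : ν ≤ 1) (hh : 0 < h) (hlam : 0 < lam)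
    [IsProbabilityMeasure (holdingLaw ν h lam)] :
    Tendsto (rateM ν h lam) (𝓝[>] 0) (𝓝 (rateM ν h lam 0)) := by
  rcases hν1.lt_or_eq with hν1 | rfl
  · rw [rateM_zero, if_neg hν1.ne]
    have hl : Tendsto (fun x : ℝ => x * (h / lam)) (𝓝[>] 0) (𝓝 0) := by
      have : Tendsto (fun x : ℝ => x * (h / lam)) (𝓝 0) (𝓝 (0 * (h / lam))) :=
        tendsto_id.mul_const _
      rw [zero_mul] at this
      exact this.mono_left nhdsWithin_le_nhds
    have hl' : Tendsto (fun x : ℝ => ((x * (h / lam) : ℝ) : EReal)) (𝓝[>] 0) (𝓝 0) :=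
      (continuous_coe_real_ereal.tendsto 0).comp hl
    refine tendsto_of_tendsto_of_tendsto_of_le_of_le' tendsto_const_nhds hl'
      (Eventually.of_forall fun x => rateM_nonneg hν0 hh hlam x) ?_
    filter_upwards [hl.eventually_lt_const one_pos, self_mem_nhdsWithin] with x h1 hx
    exact rateM_le_mul hν0 hν1 hh hlam hx h1.le
  · have hc : Continuous fun x : ℝ => h * x * Real.log (h * x / lam) - h * x + lam := by
      have e : ∀ x : ℝ, h * x * Real.log (h * x / lam) =
          lam * ((h * x / lam) * Real.log (h * x / lam)) := fun x => by field_simp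
      simp only [e]
      have : Continuous fun x : ℝ => (h * x / lam) * Real.log (h * x / lam) :=
        Real.continuous_mul_log.comp (by fun_prop : Continuous fun x : ℝ => h * x / lam)
      fun_prop
    have h1 := ((continuous_coe_real_ereal.comp hc).tendsto 0).mono_left
      (nhdsWithin_le_nhds (s := Set.Ioi 0))
    rw [rateM_one hh hlam 0, if_pos le_rfl]
    refine h1.congr' ?_
    filter_upwards [self_mem_nhdsWithin] with x hx
    rw [rateM_one hh hlam, if_pos (le_of_lt hx)]
    rfl

lemma tendsto_rateM_atTop (hν0 : 0 < ν) (hh : 0 < h) (hlam : 0 < lam)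
    [IsProbabilityMeasure (holdingLaw ν h lam)] :
    Tendsto (rateM ν h lam) atTop (𝓝 ⊤) := by
  have hk := holdingCGF_neg_one_neg (ν := ν) hh hlam
  have h1 : Tendsto (fun x : ℝ => -1 - x * holdingCGF ν h lam (-1)) atTop atTop := by
    have : Tendsto (fun x : ℝ => x * -holdingCGF ν h lam (-1)) atTop atTop :=
      tendsto_id.atTop_mul_const (by linarith)
    refine (tendsto_atTop_add_const_left _ (-1) this).congr fun x => by ring
  have h2 := EReal.tendsto_coe_nhds_top_iff.2 h1
  refine tendsto_of_tendsto_of_tendsto_of_le_of_le' h2 tendsto_const_nhds ?_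
    (Eventually.of_forall fun _ => le_top)
  filter_upwards [eventually_ge_atTop 0] with x hx
  exact le_rateM hν0 hh hlam (neg_mem_cgfDomain hlam neg_one_lt_zero) hx

end FracPoisson

/-! ### Renewal sequences: inversion and Chernoff bounds -/

namespace FracPoisson

lemma limsup_inv_mul_log_le {p : ℝ → ℝ≥0∞} {K c : ℝ} (hK : 0 < K)
    (hp : ∀ᶠ t in atTop, p t ≤ ENNReal.ofReal (K * Real.exp (-(c * t)))) :
    limsup (fun t : ℝ => ((1 / t : ℝ) : EReal) * ENNReal.log (p t)) atTop ≤ ((-c : ℝ) : EReal) := by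
  have hlim : Tendsto (fun t : ℝ => ((Real.log K / t - c : ℝ) : EReal)) atTop
      (𝓝 ((-c : ℝ) : EReal)) := by
    refine (continuous_coe_real_ereal.tendsto _).comp ?_
    have := (tendsto_const_nhds (x := Real.log K)).div_atTop tendsto_id
    simpa using this.sub_const c
  rw [← hlim.limsup_eq]
  refine limsup_le_limsup ?_
  filter_upwards [hp, eventually_gt_atTop 0] with t ht ht0
  have hl := ENNReal.log_monotone ht
  rw [ENNReal.log_ofReal_of_pos (by positivity), Real.log_mul hK.ne' (Real.exp_pos _).ne',
    Real.log_exp] at hl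
  calc ((1 / t : ℝ) : EReal) * ENNReal.log (p t)
      ≤ ((1 / t : ℝ) : EReal) * ((Real.log K + -(c * t) : ℝ) : EReal) := by gcongr
    _ = _ := by
      rw [← EReal.coe_mul]
      congr 1
      field_simp
      ring

lemma le_liminf_inv_mul_log {p : ℝ → ℝ≥0∞} {K c : ℝ} (hK : 0 < K)
    (hp : ∀ᶠ t in atTop, ENNReal.ofReal (K * Real.exp (-(c * t))) ≤ p t) :
    ((-c : ℝ) : EReal) ≤
      liminf (fun t : ℝ => ((1 / t : ℝ) : EReal) * ENNReal.log (p t)) atTop := by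
  have hlim : Tendsto (fun t : ℝ => ((Real.log K / t - c : ℝ) : EReal)) atTop
      (𝓝 ((-c : ℝ) : EReal)) := by
    refine (continuous_coe_real_ereal.tendsto _).comp ?_
    have := (tendsto_const_nhds (x := Real.log K)).div_atTop tendsto_id
    simpa using this.sub_const c
  rw [← hlim.liminf_eq]
  refine liminf_le_liminf ?_
  filter_upwards [hp, eventually_gt_atTop 0] with t ht ht0
  have hl := ENNReal.log_monotone ht
  rw [ENNReal.log_ofReal_of_pos (by positivity), Real.log_mul hK.ne' (Real.exp_pos _).ne',
    Real.log_exp] at hl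
  calc ((Real.log K / t - c : ℝ) : EReal)
      = ((1 / t : ℝ) : EReal) * ((Real.log K + -(c * t) : ℝ) : EReal) := by
        rw [← EReal.coe_mul]
        congr 1
        field_simp
        ring
    _ ≤ _ := by gcongr

/-- The time `T₁ + ⋯ + Tₙ` of the `n`-th renewal. -/
def renewalTime {Ω : Type*} (T : ℕ → Ω → ℝ) (n : ℕ) (ω : Ω) : ℝ := ∑ i ∈ Finset.range n, T i ω

/-- A sequence of independent positive random variables with common cumulant generating function
`k` on the set `D`. -/
structure IsRenewalSequence {Ω : Type*} [MeasurableSpace Ω] (P : Measure Ω) (T : ℕ → Ω → ℝ)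
    (D : Set ℝ) (k : ℝ → ℝ) : Prop where
  measurable : ∀ n, Measurable (T n)
  indep : iIndepFun T P
  pos : ∀ n, ∀ᵐ ω ∂P, 0 < T n ω
  integrable_exp : ∀ n, ∀ θ ∈ D, Integrable (fun ω => Real.exp (θ * T n ω)) P
  mgf_eq : ∀ n, ∀ θ ∈ D, mgf (T n) P θ = Real.exp (k θ)

section Counting

variable {Ω : Type*} {T : ℕ → Ω → ℝ} {ω : Ω}

lemma monotone_renewalTime (hT : ∀ n, 0 < T n ω) : Monotone fun n => renewalTime T n ω :=
  monotone_nat_of_le_succ fun n => by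
    simp only [renewalTime, Finset.sum_range_succ]
    linarith [hT n]

lemma countingProcess_eq_tsum (t : ℝ) : countingProcess T t ω =
    ∑' n : ℕ, if renewalTime T (n + 1) ω ≤ t then (1 : ℝ≥0∞) else 0 := rfl

lemma le_countingProcess (hT : ∀ n, 0 < T n ω) {n : ℕ} {t : ℝ} (h : renewalTime T n ω ≤ t) :
    (n : ℝ≥0∞) ≤ countingProcess T t ω := by
  rw [countingProcess_eq_tsum]
  refine le_trans ?_ (ENNReal.sum_le_tsum (Finset.range n))
  rw [Finset.sum_congr rfl fun i hi => if_pos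
    ((monotone_renewalTime hT (Finset.mem_range.1 hi : i + 1 ≤ n)).trans h)]
  simp

lemma countingProcess_le (hT : ∀ n, 0 < T n ω) {n : ℕ} {t : ℝ} (h : t < renewalTime T (n + 1) ω) :
    countingProcess T t ω ≤ n := by
  rw [countingProcess_eq_tsum, tsum_eq_sum (s := Finset.range n)]
  · refine (Finset.sum_le_sum fun i _ => (?_ : _ ≤ (1 : ℝ≥0∞))).trans (by simp)
    split_ifs <;> simp
  · intro i hi
    rw [Finset.mem_range, not_lt] at hi
    exact if_neg (not_le.2 (h.trans_le (monotone_renewalTime hT (by omega : n + 1 ≤ i + 1))))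

lemma renewalTime_le_of_le_countingProcess (hT : ∀ n, 0 < T n ω) {b t : ℝ} (hb : 0 < b)
    (ht : 0 < t) (h : b ≤ (countingProcess T t ω).toReal / t) :
    renewalTime T ⌈b * t⌉₊ ω ≤ t := by
  by_contra hlt
  have hpos : 0 < ⌈b * t⌉₊ := Nat.ceil_pos.2 (by positivity)
  obtain ⟨n, hn⟩ : ∃ n, ⌈b * t⌉₊ = n + 1 := ⟨_, (Nat.succ_pred_eq_of_pos hpos).symm⟩
  rw [hn] at hlt
  have h1 := ENNReal.toReal_mono (by simp) (countingProcess_le hT (not_le.1 hlt))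
  rw [ENNReal.toReal_natCast] at h1
  rw [le_div_iff₀ ht] at h
  have h2 : (n : ℝ) < b * t := Nat.lt_ceil.1 (by omega)
  linarith

/-- Finiteness matters: `toReal` sends `⊤` to 0, so an infinite count would pass for a small one. -/
lemma lt_renewalTime_of_countingProcess_le (hT : ∀ n, 0 < T n ω) {a t : ℝ}
    (ht : 0 < t) (hfin : countingProcess T t ω ≠ ⊤) (h : (countingProcess T t ω).toReal / t ≤ a) :
    t < renewalTime T (⌊a * t⌋₊ + 1) ω := by
  by_contra hlt
  have h1 := ENNReal.toReal_mono hfin (le_countingProcess hT (not_lt.1 hlt))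
  rw [ENNReal.toReal_natCast] at h1
  rw [div_le_iff₀ ht] at h
  have h2 := Nat.lt_floor_add_one (a * t)
  push_cast at h1
  linarith

lemma countingProcess_mem_Ico (hT : ∀ n, 0 < T n ω) {n m : ℕ} {t : ℝ}
    (hn : renewalTime T n ω ≤ t) (hm : t < renewalTime T m ω) (ht : 0 < t) :
    (n : ℝ) ≤ (countingProcess T t ω).toReal ∧ (countingProcess T t ω).toReal < m := by
  obtain ⟨l, rfl⟩ : ∃ l, m = l + 1 := by
    refine Nat.exists_eq_succ_of_ne_zero ?_
    rintro rfl
    simp only [renewalTime, Finset.range_zero, Finset.sum_empty] at hm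
    linarith
  have h1 := countingProcess_le hT hm
  have h2 := ENNReal.toReal_mono (by simp) h1
  have h3 := ENNReal.toReal_mono (ne_top_of_le_ne_top (by simp) h1) (le_countingProcess hT hn)
  rw [ENNReal.toReal_natCast] at h2 h3
  refine ⟨h3, ?_⟩
  push_cast
  linarith

end Counting

namespace IsRenewalSequence

variable {Ω : Type*} [MeasurableSpace Ω] {P : Measure Ω} {T : ℕ → Ω → ℝ}
  {D : Set ℝ} {k : ℝ → ℝ}

lemma measurable_renewalTime (hT : IsRenewalSequence P T D k) (n : ℕ) :
    Measurable (renewalTime T n) :=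
  Finset.measurable_fun_sum _ fun i _ => hT.measurable i

lemma ae_pos (hT : IsRenewalSequence P T D k) : ∀ᵐ ω ∂P, ∀ n, 0 < T n ω := ae_all_iff.2 hT.pos

variable [IsProbabilityMeasure P]

lemma exp_weighted_sum (hT : IsRenewalSequence P T D k) (c : ℕ → ℝ) (hc : ∀ i, c i ∈ D) (n : ℕ) :
    Integrable (fun ω => Real.exp (∑ i ∈ Finset.range n, c i * T i ω)) P ∧
      ∫ ω, Real.exp (∑ i ∈ Finset.range n, c i * T i ω) ∂P =
        Real.exp (∑ i ∈ Finset.range n, k (c i)) := by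
  have hind : iIndepFun (fun i ω => c i * T i ω) P :=
    hT.indep.comp (fun i x => c i * x) fun i => by fun_prop
  have hm : ∀ i, Measurable fun ω => c i * T i ω := fun i => (hT.measurable i).const_mul _
  have h1 := hind.integrable_exp_mul_sum hm (t := 1) (s := Finset.range n) fun i _ => by
    simpa using hT.integrable_exp i (c i) (hc i)
  have h2 := hind.mgf_sum hm (t := 1) (Finset.range n)
  simp only [Finset.sum_apply, one_mul] at h1
  refine ⟨h1, ?_⟩
  simp only [mgf_const_mul, mul_one, hT.mgf_eq _ _ (hc _), ← Real.exp_sum] at h2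
  rw [← h2, mgf]
  simp only [Finset.sum_apply, one_mul]

/-- Separate exponents before and after the `n`-th renewal allow an extra tilt of the first block
alone. -/
lemma exp_renewalTime_pair (hT : IsRenewalSequence P T D k) {a b : ℝ} (ha : a ∈ D) (hb : b ∈ D)
    {n m : ℕ} (hnm : n ≤ m) :
    Integrable (fun ω => Real.exp (a * renewalTime T n ω +
        b * (renewalTime T m ω - renewalTime T n ω))) P ∧
      ∫ ω, Real.exp (a * renewalTime T n ω + b * (renewalTime T m ω - renewalTime T n ω)) ∂P =
        Real.exp (n * k a + (m - n) * k b) := by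
  have H := hT.exp_weighted_sum (fun i => if i < n then a else b)
    (fun i => by split_ifs <;> assumption) m
  obtain ⟨l, rfl⟩ := Nat.exists_eq_add_of_le hnm
  have e : ∀ ω, ∑ i ∈ Finset.range (n + l), (if i < n then a else b) * T i ω =
      a * renewalTime T n ω + b * (renewalTime T (n + l) ω - renewalTime T n ω) := by
    intro ω
    simp only [renewalTime, Finset.sum_range_add, add_sub_cancel_left, Finset.mul_sum]
    congr 1
    · exact Finset.sum_congr rfl fun i hi => by rw [if_pos (Finset.mem_range.1 hi)]
    · exact Finset.sum_congr rfl fun i hi => by rw [if_neg (by omega)]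
  have e2 : ∑ i ∈ Finset.range (n + l), k (if i < n then a else b) =
      n * k a + (((n + l : ℕ) : ℝ) - n) * k b := by
    rw [Finset.sum_range_add, Finset.sum_congr rfl fun i hi => by rw [if_pos (Finset.mem_range.1 hi)],
      Finset.sum_congr (s₁ := Finset.range l) rfl fun i hi => by rw [if_neg (by omega)]]
    simp
  simpa only [e, e2] using H

lemma exp_renewalTime (hT : IsRenewalSequence P T D k) {θ : ℝ} (hθ : θ ∈ D) (n : ℕ) :
    Integrable (fun ω => Real.exp (θ * renewalTime T n ω)) P ∧
      mgf (renewalTime T n) P θ = Real.exp (n * k θ) := by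
  simpa [mgf] using hT.exp_renewalTime_pair hθ hθ (le_refl n)

lemma measure_renewalTime_le (hT : IsRenewalSequence P T D k) {θ : ℝ} (hθ : θ ∈ D) (hθ0 : θ ≤ 0)
    (n : ℕ) (t : ℝ) :
    P {ω | renewalTime T n ω ≤ t} ≤ ENNReal.ofReal (Real.exp (-θ * t + n * k θ)) := by
  obtain ⟨h1, h2⟩ := hT.exp_renewalTime hθ n
  have := measure_le_le_exp_mul_mgf t hθ0 h1
  rw [h2, ← Real.exp_add] at this
  rw [← ofReal_measureReal]
  exact ENNReal.ofReal_le_ofReal this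

lemma measure_le_renewalTime (hT : IsRenewalSequence P T D k) {θ : ℝ} (hθ : θ ∈ D) (hθ0 : 0 ≤ θ)
    (n : ℕ) (t : ℝ) :
    P {ω | t ≤ renewalTime T n ω} ≤ ENNReal.ofReal (Real.exp (-θ * t + n * k θ)) := by
  obtain ⟨h1, h2⟩ := hT.exp_renewalTime hθ n
  have := measure_ge_le_exp_mul_mgf t hθ0 h1
  rw [h2, ← Real.exp_add] at this
  rw [← ofReal_measureReal]
  exact ENNReal.ofReal_le_ofReal this

/-- By Chernoff, the probability of `S_n ≤ N` decays like `exp (n k(θ))`, so the renewal times are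
almost surely unbounded. -/
lemma ae_countingProcess_ne_top (hT : IsRenewalSequence P T D k) {θ : ℝ} (hθ : θ ∈ D)
    (hθ0 : θ ≤ 0) (hk : k θ < 0) : ∀ᵐ ω ∂P, ∀ t : ℝ, countingProcess T t ω ≠ ⊤ := by
  have h1 : ∀ᵐ ω ∂P, ∀ N : ℕ, ∃ n, (N : ℝ) < renewalTime T n ω := by
    refine ae_all_iff.2 fun N => ?_
    rw [ae_iff]
    have hlim : Tendsto (fun n : ℕ => ENNReal.ofReal (Real.exp (-θ * N + n * k θ))) atTop (𝓝 0) := by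
      rw [← ENNReal.ofReal_zero]
      refine ENNReal.tendsto_ofReal (Real.tendsto_exp_atBot.comp ?_)
      exact tendsto_atBot_add_const_left _ _ (tendsto_natCast_atTop_atTop.atTop_mul_const_of_neg hk)
    refine le_antisymm (ge_of_tendsto' hlim fun n => ?_) bot_le
    refine (measure_mono fun ω hω => ?_).trans (hT.measure_renewalTime_le hθ hθ0 n N)
    simp only [Set.mem_ofPred_eq, not_exists, not_lt] at hω ⊢
    exact hω n
  filter_upwards [h1, hT.ae_pos] with ω hω hpos t
  obtain ⟨N, hN⟩ := exists_nat_ge t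
  obtain ⟨n, hn⟩ := hω N
  have : t < renewalTime T (n + 1) ω :=
    hN.trans_lt (hn.trans_le (monotone_renewalTime hpos n.le_succ))
  exact ne_top_of_le_ne_top (by simp) (countingProcess_le hpos this)

lemma measure_right_tail_le (hT : IsRenewalSequence P T D k) {θ : ℝ} (hθ : θ ∈ D)
    (hθ0 : θ ≤ 0) (hk : k θ ≤ 0) {b t : ℝ} (hb : 0 < b) (ht : 0 < t) :
    P {ω | b ≤ (countingProcess T t ω).toReal / t} ≤
      ENNReal.ofReal (Real.exp (-((θ - b * k θ) * t))) := by
  calc P {ω | b ≤ (countingProcess T t ω).toReal / t}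
      ≤ P {ω | renewalTime T ⌈b * t⌉₊ ω ≤ t} := by
        refine measure_mono_ae ?_
        filter_upwards [hT.ae_pos] with ω hpos hω
        exact renewalTime_le_of_le_countingProcess hpos hb ht hω
    _ ≤ _ := hT.measure_renewalTime_le hθ hθ0 _ t
    -- Rounding `b t` up costs nothing because `k θ ≤ 0`.
    _ ≤ _ := by
        gcongr
        have := Nat.le_ceil (b * t)
        nlinarith

lemma measure_left_tail_le (hT : IsRenewalSequence P T D k) {θ : ℝ} (hθ : θ ∈ D)
    (hθ0 : 0 ≤ θ) (hk : 0 ≤ k θ) (hfin : ∀ᵐ ω ∂P, ∀ t : ℝ, countingProcess T t ω ≠ ⊤)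
    {a t : ℝ} (ha : 0 ≤ a) (ht : 0 < t) :
    P {ω | (countingProcess T t ω).toReal / t ≤ a} ≤
      ENNReal.ofReal (Real.exp (k θ) * Real.exp (-((θ - a * k θ) * t))) := by
  calc P {ω | (countingProcess T t ω).toReal / t ≤ a}
      ≤ P {ω | t ≤ renewalTime T (⌊a * t⌋₊ + 1) ω} := by
        refine measure_mono_ae ?_
        filter_upwards [hT.ae_pos, hfin] with ω hpos hf hω
        exact (lt_renewalTime_of_countingProcess_le hpos ht (hf t) hω).le
    _ ≤ _ := hT.measure_le_renewalTime hθ hθ0 _ t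
    -- The extra renewal in `⌊a t⌋ + 1` accounts for the prefactor `exp (k θ)`.
    _ ≤ _ := by
        rw [← Real.exp_add]
        refine ENNReal.ofReal_le_ofReal (Real.exp_le_exp.2 ?_)
        have := Nat.floor_le (show 0 ≤ a * t by positivity)
        push_cast
        nlinarith

end IsRenewalSequence

/-! ### The local lower bound by exponential tilting -/

lemma tendsto_exp_mul_add_const_of_neg {a : ℝ} (ha : a < 0) (b : ℝ) :
    Tendsto (fun t : ℝ => Real.exp (t * a + b)) atTop (𝓝 0) :=
  Real.tendsto_exp_atBot.comp
    (tendsto_atBot_add_const_right _ _ (tendsto_id.atTop_mul_const_of_neg ha))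

/-- Increments of a function with positive derivative `1 / x`, compared with slopes close to
`1 / x`. -/
lemma exists_increment_bounds {D : Set ℝ} {k : ℝ → ℝ} {θ x l u : ℝ} (hD : D ∈ 𝓝 θ)
    (hk : HasDerivAt k (1 / x) θ) (hl : l < 1 / x) (hu : 1 / x < u) :
    ∃ η > 0, θ - η ∈ D ∧ θ + η ∈ D ∧ η * l < k θ - k (θ - η) ∧ k (θ + η) - k θ < η * u ∧
      η * l < k (θ + η) - k θ := by
  obtain ⟨c, hc, hcl, hcu⟩ : ∃ c > 0, l < 1 / x - c ∧ 1 / x + c < u := by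
    refine ⟨min (1 / x - l) (u - 1 / x) / 2, ?_, ?_, ?_⟩
    · have : 0 < min (1 / x - l) (u - 1 / x) := lt_min (by linarith) (by linarith)
      linarith
    · have := min_le_left (1 / x - l) (u - 1 / x); linarith
    · have := min_le_right (1 / x - l) (u - 1 / x); linarith
  have h1 := (hasDerivAt_iff_isLittleO_nhds_zero.1 hk).bound hc
  have hp : Tendsto (fun η : ℝ => θ + η) (𝓝 0) (𝓝 θ) := by
    have : Continuous fun η : ℝ => θ + η := by fun_prop
    simpa using this.tendsto 0
  have h2 := hp.eventually hD
  have h3 : ∀ᶠ η in 𝓝 (0 : ℝ), (‖k (θ + η) - k θ - η • (1 / x)‖ ≤ c * ‖η‖ ∧ θ + η ∈ D) ∧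
      (‖k (θ + -η) - k θ - (-η) • (1 / x)‖ ≤ c * ‖-η‖ ∧ θ + -η ∈ D) := by
    refine (h1.and h2).and ?_
    have hn : Tendsto (fun η : ℝ => -η) (𝓝 0) (𝓝 0) := by simpa using tendsto_neg (0 : ℝ)
    exact hn.eventually (h1.and h2)
  obtain ⟨η, ⟨⟨e1, m1⟩, e2, m2⟩, hη⟩ :=
    ((h3.filter_mono nhdsWithin_le_nhds).and (self_mem_nhdsWithin (s := Set.Ioi (0 : ℝ)))).exists
  replace hη : 0 < η := hη
  rw [norm_neg] at e2
  rw [Real.norm_eq_abs, Real.norm_eq_abs, abs_of_pos hη, smul_eq_mul, abs_le] at e1 e2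
  have q1 : η * l < η * (1 / x - c) := by gcongr
  have q2 : η * (1 / x + c) < η * u := by gcongr
  rw [← sub_eq_add_neg] at m2 e2
  refine ⟨η, hη, m2, m1, ?_, ?_, ?_⟩ <;> nlinarith

namespace IsRenewalSequence

variable {Ω : Type*} [MeasurableSpace Ω] {P : Measure Ω} [IsProbabilityMeasure P] {T : ℕ → Ω → ℝ}
  {D : Set ℝ} {k : ℝ → ℝ}

/-- A lower bound, by exponential tilting, for the probability that the `n`-th renewal happens
before time `t` and the `m`-th one shortly after. -/
lemma one_le_tilted (hT : IsRenewalSequence P T D k) {θ η ε t A : ℝ} (hθ : θ ∈ D) (hη : 0 < η)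
    (hm : θ - η ∈ D) (hp : θ + η ∈ D) {n m : ℕ} (hnm : n ≤ m)
    (hA : ∀ s, t < s → s ≤ (1 + ε) * t → θ * s - m * k θ ≤ A) :
    1 ≤ Real.exp A * P.real {ω | renewalTime T n ω ≤ t ∧ t < renewalTime T m ω} +
      (Real.exp (η * t - m * (k θ - k (θ - η))) +
       Real.exp (m * (k (θ + η) - k θ) - η * ((1 + ε) * t)) +
       Real.exp (n * (k (θ + η) - k θ) - η * t)) := by
  set S := renewalTime T n
  set S' := renewalTime T m
  have hSm : Measurable S := hT.measurable_renewalTime n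
  have hSm' : Measurable S' := hT.measurable_renewalTime m
  set B : Set Ω := {ω | S ω ≤ t ∧ t < S' ω} with hB
  have hBm : MeasurableSet B :=
    (measurableSet_le hSm measurable_const).inter (measurableSet_lt measurable_const hSm')
  have key : ∀ a b C : ℝ, a ∈ D → b ∈ D →
      Integrable (fun ω => Real.exp (a * S ω + b * (S' ω - S ω) + C)) P ∧
      ∫ ω, Real.exp (a * S ω + b * (S' ω - S ω) + C) ∂P =
        Real.exp (n * k a + (m - n) * k b + C) := by
    intro a b C ha hb
    obtain ⟨h1, h2⟩ := hT.exp_renewalTime_pair ha hb hnm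
    simp only [Real.exp_add _ C]
    exact ⟨h1.mul_const _, by rw [integral_mul_const, h2]⟩
  obtain ⟨i0, v0⟩ := key θ θ (-(m * k θ)) hθ hθ
  obtain ⟨i1, v1⟩ := key (θ - η) (θ - η) (η * t - m * k θ) hm hm
  obtain ⟨i2, v2⟩ := key (θ + η) (θ + η) (-(η * ((1 + ε) * t)) - m * k θ) hp hp
  obtain ⟨i3, v3⟩ := key (θ + η) θ (-(η * t) - m * k θ) hp hθ
  have iB : Integrable (B.indicator fun _ => Real.exp A) P := (integrable_const _).indicator hBm
  -- The left side is the tilting density `exp (θ S_m - m k(θ))`, of mean 1. The three error terms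
  -- are Chernoff bounds under the tilted law for `S_m ≤ t`, `S_m > (1 + ε) t` and `S_n > t`; on the
  -- remaining event the density is at most `exp A`.
  have hle : ∀ ω, Real.exp (θ * S ω + θ * (S' ω - S ω) + -(m * k θ)) ≤
      B.indicator (fun _ => Real.exp A) ω +
      (Real.exp ((θ - η) * S ω + (θ - η) * (S' ω - S ω) + (η * t - m * k θ)) +
       Real.exp ((θ + η) * S ω + (θ + η) * (S' ω - S ω) + (-(η * ((1 + ε) * t)) - m * k θ)) +
       Real.exp ((θ + η) * S ω + θ * (S' ω - S ω) + (-(η * t) - m * k θ))) := by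
    intro ω
    have hB0 : 0 ≤ B.indicator (fun _ => Real.exp A) ω :=
      Set.indicator_nonneg (fun _ _ => (Real.exp_pos _).le) ω
    set E1 := Real.exp ((θ - η) * S ω + (θ - η) * (S' ω - S ω) + (η * t - m * k θ)) with hE1
    set E2 := Real.exp ((θ + η) * S ω + (θ + η) * (S' ω - S ω) +
      (-(η * ((1 + ε) * t)) - m * k θ)) with hE2
    set E3 := Real.exp ((θ + η) * S ω + θ * (S' ω - S ω) + (-(η * t) - m * k θ)) with hE3
    have p1 : 0 < E1 := Real.exp_pos _
    have p2 : 0 < E2 := Real.exp_pos _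
    have p3 : 0 < E3 := Real.exp_pos _
    rcases le_or_gt (S' ω) t with c1 | c1
    · have : Real.exp (θ * S ω + θ * (S' ω - S ω) + -(m * k θ)) ≤ E1 := by
        rw [hE1, Real.exp_le_exp]
        nlinarith
      linarith
    rcases lt_or_ge ((1 + ε) * t) (S' ω) with c2 | c2
    · have : Real.exp (θ * S ω + θ * (S' ω - S ω) + -(m * k θ)) ≤ E2 := by
        rw [hE2, Real.exp_le_exp]
        nlinarith
      linarith
    rcases lt_or_ge t (S ω) with c3 | c3
    · have : Real.exp (θ * S ω + θ * (S' ω - S ω) + -(m * k θ)) ≤ E3 := by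
        rw [hE3, Real.exp_le_exp]
        nlinarith
      linarith
    · have h1 : B.indicator (fun _ => Real.exp A) ω = Real.exp A :=
        Set.indicator_of_mem (show ω ∈ B from ⟨c3, c1⟩) _
      have : Real.exp (θ * S ω + θ * (S' ω - S ω) + -(m * k θ)) ≤ Real.exp A := by
        rw [Real.exp_le_exp]
        have := hA _ c1 c2
        linarith
      linarith
  have hint := integral_mono i0 (iB.add ((i1.add i2).add i3)) hle
  have hv0 : Real.exp (n * k θ + (m - n) * k θ + -(m * k θ)) = 1 := by
    rw [show n * k θ + (m - n) * k θ + -(m * k θ) = 0 by ring, Real.exp_zero]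
  have hsum : ∫ ω, (B.indicator (fun _ => Real.exp A) + ((fun ω =>
      Real.exp ((θ - η) * S ω + (θ - η) * (S' ω - S ω) + (η * t - m * k θ))) + (fun ω =>
       Real.exp ((θ + η) * S ω + (θ + η) * (S' ω - S ω) + (-(η * ((1 + ε) * t)) - m * k θ))) +
       fun ω => Real.exp ((θ + η) * S ω + θ * (S' ω - S ω) + (-(η * t) - m * k θ)))) ω ∂P =
       Real.exp A * P.real B + (Real.exp (η * t - m * (k θ - k (θ - η))) +
       Real.exp (m * (k (θ + η) - k θ) - η * ((1 + ε) * t)) +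
       Real.exp (n * (k (θ + η) - k θ) - η * t)) := by
    rw [integral_add' iB ((i1.add i2).add i3), integral_add' (i1.add i2) i3, integral_add' i1 i2,
      v1, v2, v3, integral_indicator_const _ hBm, smul_eq_mul, mul_comm]
    ring_nf
  rw [v0, hv0] at hint
  exact hint.trans_eq hsum

/-- The local large deviation lower bound. -/
lemma eventually_le_measure (hT : IsRenewalSequence P T D k) {θ x δ : ℝ} (hD : D ∈ 𝓝 θ)
    (hδ : 0 < δ) (hδx : δ < x) (hk : HasDerivAt k (1 / x) θ) :
    ∀ᶠ t in atTop, ENNReal.ofReal (Real.exp (-|k θ|) / 2 *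
        Real.exp (-((θ - x * k θ + (|k θ| + 2 / x * |θ|) * δ) * t))) ≤
      P {ω | (countingProcess T t ω).toReal / t ∈ Set.Ico (x - δ) (x + δ)} := by
  have hx : 0 < x := hδ.trans hδx
  have hxδ : 0 < x - δ := sub_pos.2 hδx
  -- Under the tilt `S_n` is near `(1 - δ / x) t` and `S_m` near `(1 + δ / x) t`. With this `ε` the
  -- latter lies strictly between `t` and `(1 + ε) t`, so the exponents `a1`, `a2`, `a3` below are
  -- negative.
  set ε := 2 * (δ / x) with hε
  have hε0 : 0 < ε := by positivity
  obtain ⟨η, hη, hm, hp, hd1, hd2, hd2'⟩ := exists_increment_bounds (l := 1 / (x + δ))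
    (u := min ((1 + ε) / (x + δ)) (1 / (x - δ))) hD hk
    (by gcongr; linarith) (lt_min
      (by
        rw [div_lt_div_iff₀ hx (by positivity), hε]
        have : (1 + 2 * (δ / x)) * x = x + 2 * δ := by field_simp
        rw [this]
        linarith)
      (by gcongr; linarith))
  set d₁ := k θ - k (θ - η)
  set d₂ := k (θ + η) - k θ
  have hd1p : 0 < d₁ := lt_trans (by positivity) hd1
  have hd2p : 0 < d₂ := lt_trans (by positivity) hd2'
  have a1 : η - (x + δ) * d₁ < 0 := by
    have : (x + δ) * (η * (1 / (x + δ))) < (x + δ) * d₁ := by gcongr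
    have e : (x + δ) * (η * (1 / (x + δ))) = η := by field_simp
    linarith
  have a2 : (x + δ) * d₂ - η * (1 + ε) < 0 := by
    have h1 : d₂ < η * ((1 + ε) / (x + δ)) := hd2.trans_le (by gcongr; exact min_le_left _ _)
    have : (x + δ) * d₂ < (x + δ) * (η * ((1 + ε) / (x + δ))) := by gcongr
    have e : (x + δ) * (η * ((1 + ε) / (x + δ))) = η * (1 + ε) := by field_simp
    linarith
  have a3 : (x - δ) * d₂ - η < 0 := by
    have h1 : d₂ < η * (1 / (x - δ)) := hd2.trans_le (by gcongr; exact min_le_right _ _)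
    have : (x - δ) * d₂ < (x - δ) * (η * (1 / (x - δ))) := by gcongr
    have e : (x - δ) * (η * (1 / (x - δ))) = η := by field_simp
    linarith
  have hR : Tendsto (fun t : ℝ => Real.exp (t * (η - (x + δ) * d₁) + d₁) +
      Real.exp (t * ((x + δ) * d₂ - η * (1 + ε)) + 0) +
      Real.exp (t * ((x - δ) * d₂ - η) + d₂)) atTop (𝓝 (0 + 0 + 0)) :=
    ((tendsto_exp_mul_add_const_of_neg a1 _).add (tendsto_exp_mul_add_const_of_neg a2 _)).add
      (tendsto_exp_mul_add_const_of_neg a3 _)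
  rw [add_zero, add_zero] at hR
  filter_upwards [hR.eventually_lt_const (show (0 : ℝ) < 1 / 2 by norm_num),
    eventually_gt_atTop 0, eventually_ge_atTop (1 / δ)] with t hRt ht htδ
  have htδ' : 1 ≤ t * δ := (div_le_iff₀ hδ).1 htδ
  -- Rounding inwards, so that a count in `[n, m)` divided by `t` lies in `[x - δ, x + δ)`; `t ≥ 1 /
  -- δ` ensures `n ≤ m`.
  set n := ⌈(x - δ) * t⌉₊ with hn
  set m := ⌊(x + δ) * t⌋₊ with hmdef
  have n1 : (x - δ) * t ≤ n := Nat.le_ceil _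
  have n2 : (n : ℝ) < (x - δ) * t + 1 := Nat.ceil_lt_add_one (by positivity)
  have m1 : (m : ℝ) ≤ (x + δ) * t := Nat.floor_le (by positivity)
  have m2 : (x + δ) * t < m + 1 := Nat.lt_floor_add_one _
  have hnm : n ≤ m := by
    have : (n : ℝ) < m + 1 := by linarith
    exact Nat.lt_add_one_iff.1 (by exact_mod_cast this)
  set A := (θ - x * k θ + (|k θ| + 2 / x * |θ|) * δ) * t + |k θ| with hA
  have hbound : ∀ s, t < s → s ≤ (1 + ε) * t → θ * s - m * k θ ≤ A := by
    intro s hs1 hs2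
    have b1 : θ * (s - t) ≤ |θ| * (ε * t) := by
      calc θ * (s - t) ≤ |θ| * (s - t) :=
            mul_le_mul_of_nonneg_right (le_abs_self θ) (by linarith)
        _ ≤ _ := by gcongr; linarith
    have b2 : (x * t - m) * k θ ≤ |k θ| * (δ * t + 1) := by
      calc (x * t - m) * k θ ≤ |(x * t - m) * k θ| := le_abs_self _
        _ = |k θ| * |x * t - m| := by rw [abs_mul, mul_comm]
        _ ≤ _ := by
          gcongr
          rw [abs_le]
          constructor <;> linarith
    have e : |θ| * (ε * t) = 2 / x * |θ| * δ * t := by rw [hε]; ring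
    rw [e] at b1
    rw [hA]
    linarith
  have H := hT.one_le_tilted (mem_of_mem_nhds hD) hη hm hp hnm hbound
  have r1 : Real.exp (η * t - m * d₁) ≤ Real.exp (t * (η - (x + δ) * d₁) + d₁) := by
    rw [Real.exp_le_exp]
    have := mul_le_mul_of_nonneg_right m2.le hd1p.le
    linarith
  have r2 : Real.exp (m * d₂ - η * ((1 + ε) * t)) ≤
      Real.exp (t * ((x + δ) * d₂ - η * (1 + ε)) + 0) := by
    rw [Real.exp_le_exp]
    have := mul_le_mul_of_nonneg_right m1 hd2p.le
    linarith
  have r3 : Real.exp (n * d₂ - η * t) ≤ Real.exp (t * ((x - δ) * d₂ - η) + d₂) := by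
    rw [Real.exp_le_exp]
    have := mul_le_mul_of_nonneg_right n2.le hd2p.le
    linarith
  have hhalf : 1 / 2 ≤ Real.exp A *
      P.real {ω | renewalTime T n ω ≤ t ∧ t < renewalTime T m ω} := by linarith
  have hlow : Real.exp (-A) / 2 ≤ P.real {ω | renewalTime T n ω ≤ t ∧ t < renewalTime T m ω} := by
    rw [Real.exp_neg, inv_eq_one_div, div_div, div_le_iff₀ (by positivity)]
    linarith
  have hexp : Real.exp (-|k θ|) / 2 *
      Real.exp (-((θ - x * k θ + (|k θ| + 2 / x * |θ|) * δ) * t)) = Real.exp (-A) / 2 := by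
    rw [div_mul_eq_mul_div, ← Real.exp_add, hA]
    ring_nf
  rw [hexp]
  calc ENNReal.ofReal (Real.exp (-A) / 2)
      ≤ P {ω | renewalTime T n ω ≤ t ∧ t < renewalTime T m ω} := by
        rw [← ofReal_measureReal]
        exact ENNReal.ofReal_le_ofReal hlow
    _ ≤ _ := by
        refine measure_mono_ae ?_
        filter_upwards [hT.ae_pos] with ω hpos hω
        obtain ⟨c1, c2⟩ := countingProcess_mem_Ico hpos hω.1 hω.2 ht
        refine ⟨?_, ?_⟩
        · rw [le_div_iff₀ ht]; linarith
        · rw [div_lt_iff₀ ht]; linarith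

lemma neg_le_liminf_of_mem (hT : IsRenewalSequence P T D k) {θ x : ℝ} (hD : D ∈ 𝓝 θ)
    (hx : 0 < x) (hk : HasDerivAt k (1 / x) θ) {G : Set ℝ} (hG : G ∈ 𝓝 x) :
    ((-(θ - x * k θ) : ℝ) : EReal) ≤ liminf (fun t : ℝ => ((1 / t : ℝ) : EReal) *
      ENNReal.log (P {ω | (countingProcess T t ω).toReal / t ∈ G})) atTop := by
  obtain ⟨r, hr, hball⟩ := Metric.mem_nhds_iff.1 hG
  have hlim : Tendsto (fun δ : ℝ =>
      ((-(θ - x * k θ + (|k θ| + 2 / x * |θ|) * δ) : ℝ) : EReal)) (𝓝[>] 0)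
      (𝓝 ((-(θ - x * k θ) : ℝ) : EReal)) := by
    refine (continuous_coe_real_ereal.tendsto _).comp ?_
    have : Continuous fun δ : ℝ => -(θ - x * k θ + (|k θ| + 2 / x * |θ|) * δ) := by fun_prop
    have h0 := this.tendsto 0
    simp only [mul_zero, add_zero] at h0
    exact h0.mono_left nhdsWithin_le_nhds
  refine le_of_tendsto hlim ?_
  filter_upwards [Ioo_mem_nhdsGT (lt_min hr hx)] with δ hδ
  refine le_liminf_inv_mul_log (K := Real.exp (-|k θ|) / 2) (by positivity) ?_
  filter_upwards [hT.eventually_le_measure hD hδ.1 (hδ.2.trans_le (min_le_right _ _)) hk] with t ht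
  refine ht.trans (measure_mono fun ω hω => hball ?_)
  rw [Metric.mem_ball, Real.dist_eq, abs_lt]
  have h1 := hω.1
  have h2 := hω.2
  have h3 := hδ.2.trans_le (min_le_left _ _)
  constructor <;> linarith

end IsRenewalSequence

end FracPoisson

/-! ### The large deviation principle for the counting process -/

namespace FracPoisson

variable {ν h lam : ℝ} {Ω : Type*} [MeasurableSpace Ω] {P : Measure Ω}
  {T : ℕ → Ω → ℝ}

lemma isRenewalSequence_of_map_eq_holdingLaw (hν0 : 0 < ν) (hh : 0 < h) (hlam : 0 < lam)
    [IsProbabilityMeasure (holdingLaw ν h lam)] (hTmeas : ∀ n, Measurable (T n))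
    (hTindep : iIndepFun T P) (hTlaw : ∀ n, P.map (T n) = holdingLaw ν h lam) :
    IsRenewalSequence P T (cgfDomain ν lam) (holdingCGF ν h lam) := by
  have hlint : ∀ n, ∀ θ ∈ cgfDomain ν lam, ∫⁻ ω, ENNReal.ofReal (Real.exp (θ * T n ω)) ∂P =
      ENNReal.ofReal (Real.exp (holdingCGF ν h lam θ)) := by
    intro n θ hθ
    rw [← lintegral_exp_holdingLaw hν0 hh hlam hθ, ← hTlaw n,
      lintegral_map (by fun_prop) (hTmeas n)]
  have hm : ∀ n (θ : ℝ), Measurable fun ω => Real.exp (θ * T n ω) := fun n θ =>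
    ((hTmeas n).const_mul θ).exp
  refine ⟨hTmeas, hTindep, fun n => ?_, fun n θ hθ => ?_, fun n θ hθ => ?_⟩
  · have := ae_pos_holdingLaw hν0 hh hlam
    rw [← hTlaw n] at this
    exact ae_of_ae_map (hTmeas n).aemeasurable this
  · refine ⟨(hm n θ).aestronglyMeasurable, ?_⟩
    rw [hasFiniteIntegral_iff_ofReal (ae_of_all _ fun _ => (Real.exp_pos _).le), hlint n θ hθ]
    exact ENNReal.ofReal_lt_top
  · rw [mgf, integral_eq_lintegral_of_nonneg_ae (ae_of_all _ fun _ => (Real.exp_pos _).le)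
      (hm n θ).aestronglyMeasurable, hlint n θ hθ, ENNReal.toReal_ofReal (Real.exp_pos _).le]

variable [IsProbabilityMeasure P]

lemma holdingCGF_nonpos (hh : 0 < h) (hlam : 0 < lam) {θ : ℝ} (hθ : θ ≤ 0) :
    holdingCGF ν h lam θ ≤ 0 := by
  rw [holdingCGF, neg_nonpos]
  refine mul_nonneg hh.le (Real.log_nonneg ((one_le_div hlam).2 ?_))
  have := Real.rpow_nonneg (neg_nonneg.2 hθ) ν
  linarith

lemma holdingCGF_one_nonneg (hh : 0 < h) (hlam : 0 < lam) {θ : ℝ} (hθ : 0 ≤ θ) (hθl : θ < lam) :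
    0 ≤ holdingCGF 1 h lam θ := by
  rw [holdingCGF, neg_nonneg, Real.rpow_one]
  refine mul_nonpos_of_nonneg_of_nonpos hh.le
    (Real.log_nonpos (div_nonneg (by linarith) hlam.le) ((div_le_one hlam).2 (by linarith)))

/-- The zero of the rate function. -/
noncomputable def rateZero (ν h lam : ℝ) : ℝ := if ν = 1 then lam / h else 0

lemma rateZero_nonneg (hh : 0 < h) (hlam : 0 < lam) : 0 ≤ rateZero ν h lam := by
  rw [rateZero]
  split_ifs <;> positivity

lemma rateM_rateZero (hh : 0 < h) (hlam : 0 < lam)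
    [IsProbabilityMeasure (holdingLaw ν h lam)] : rateM ν h lam (rateZero ν h lam) = 0 := by
  rw [rateZero]
  split_ifs with h1
  · subst h1
    rw [rateM_one hh hlam, if_pos (by positivity), mul_div_cancel₀ _ hh.ne', div_self hlam.ne']
    simp
  · rw [rateM_zero, if_neg h1]

/-- To the right of the zero the optimal `θ` is nonpositive, the sign Chernoff requires for `S_n ≤
t`. -/
lemma exists_lt_of_rateZero_lt (hν0 : 0 < ν) (hν1 : ν ≤ 1) (hh : 0 < h) (hlam : 0 < lam)
    [IsProbabilityMeasure (holdingLaw ν h lam)] {b c : ℝ} (hb : rateZero ν h lam < b)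
    (hc : (c : EReal) < rateM ν h lam b) :
    ∃ θ ∈ cgfDomain ν lam, θ ≤ 0 ∧ c < θ - b * holdingCGF ν h lam θ := by
  have hb0 : 0 < b := (rateZero_nonneg hh hlam).trans_lt hb
  obtain ⟨θ₀, hD, hmax, h1, h2⟩ := exists_maximizer hν0 hν1 hh hlam hb0
  rw [rateM_eq_of_forall_le hν0 hν1 hh hlam hb0 (mem_of_mem_nhds hD) hmax] at hc
  refine ⟨θ₀, mem_of_mem_nhds hD, ?_, by exact_mod_cast hc⟩
  rcases hν1.lt_or_eq with hν1 | rfl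
  · exact (h2 hν1).1.le
  · rw [h1 rfl]
    rw [rateZero, if_pos rfl, div_lt_iff₀ hh] at hb
    linarith

lemma exists_lt_of_lt_rateZero (hh : 0 < h) (hlam : 0 < lam)
    [IsProbabilityMeasure (holdingLaw 1 h lam)] {a c : ℝ} (ha0 : 0 ≤ a)
    (ha : a < rateZero 1 h lam) (hc0 : 0 ≤ c) (hc : (c : EReal) < rateM 1 h lam a) :
    ∃ θ ∈ cgfDomain 1 lam, 0 ≤ θ ∧ c < θ - a * holdingCGF 1 h lam θ := by
  rcases ha0.lt_or_eq with ha0 | rfl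
  · obtain ⟨θ₀, hD, hmax, h1, -⟩ := exists_maximizer one_pos le_rfl hh hlam ha0
    rw [rateM_eq_of_forall_le one_pos le_rfl hh hlam ha0 (mem_of_mem_nhds hD) hmax] at hc
    refine ⟨θ₀, mem_of_mem_nhds hD, ?_, by exact_mod_cast hc⟩
    rw [h1 rfl]
    rw [rateZero, if_pos rfl, lt_div_iff₀ hh] at ha
    linarith
  -- At `a = 0` there is no maximizer; an approximate one serves, and `c ≥ 0` forces its sign.
  · obtain ⟨θ, hθ, hlt⟩ := (lt_rateM_iff one_pos le_rfl hh hlam le_rfl).1 hc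
    have hlt' : c < θ - 0 * holdingCGF 1 h lam θ := by exact_mod_cast hlt
    exact ⟨θ, hθ, by linarith, hlt'⟩

namespace IsRenewalSequence

lemma measure_right_part_le
    (hT : IsRenewalSequence P T (cgfDomain ν lam) (holdingCGF ν h lam)) (hν0 : 0 < ν) (hν1 : ν ≤ 1)
    (hh : 0 < h) (hlam : 0 < lam) [IsProbabilityMeasure (holdingLaw ν h lam)] {C : Set ℝ}
    (hC : IsClosed C) (hmem : rateZero ν h lam ∉ C) {c : ℝ}
    (hc : ∀ x ∈ C, (c : EReal) < rateM ν h lam x) {t : ℝ} (ht : 0 < t) :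
    P {ω | (countingProcess T t ω).toReal / t ∈ C ∩ Set.Ici (rateZero ν h lam)} ≤
      ENNReal.ofReal (Real.exp (-(c * t))) := by
  rcases (C ∩ Set.Ici (rateZero ν h lam)).eq_empty_or_nonempty with he | hne
  · simp [he]
  · have hbdd : BddBelow (C ∩ Set.Ici (rateZero ν h lam)) := ⟨_, fun _ hx => hx.2⟩
    obtain ⟨hbC, hbx⟩ := (hC.inter isClosed_Ici).csInf_mem hne hbdd
    -- The point of `C` nearest to the zero from the right: a single tail event then covers this
    -- whole part of `C`.
    set b := sInf (C ∩ Set.Ici (rateZero ν h lam))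
    have hb : rateZero ν h lam < b := lt_of_le_of_ne hbx fun he => hmem (he ▸ hbC)
    obtain ⟨θ, hθ, hθ0, hlt⟩ := exists_lt_of_rateZero_lt hν0 hν1 hh hlam hb (hc b hbC)
    calc _ ≤ P {ω | b ≤ (countingProcess T t ω).toReal / t} :=
          measure_mono fun ω hω => csInf_le hbdd hω
      _ ≤ _ := hT.measure_right_tail_le hθ hθ0 (holdingCGF_nonpos hh hlam hθ0)
          ((rateZero_nonneg hh hlam).trans_lt hb) ht
      _ ≤ _ := by gcongr

lemma measure_left_part_le
    (hT : IsRenewalSequence P T (cgfDomain ν lam) (holdingCGF ν h lam))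
    (hh : 0 < h) (hlam : 0 < lam) [IsProbabilityMeasure (holdingLaw ν h lam)]
    (hfin : ∀ᵐ ω ∂P, ∀ t : ℝ, countingProcess T t ω ≠ ⊤) {C : Set ℝ}
    (hC : IsClosed C) (hmem : rateZero ν h lam ∉ C) {c : ℝ} (hc0 : 0 ≤ c)
    (hc : ∀ x ∈ C, (c : EReal) < rateM ν h lam x) :
    ∃ K > 0, ∀ t > 0,
      P {ω | (countingProcess T t ω).toReal / t ∈ C ∩ Set.Icc 0 (rateZero ν h lam)} ≤
        ENNReal.ofReal (K * Real.exp (-(c * t))) := by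
  rcases (C ∩ Set.Icc 0 (rateZero ν h lam)).eq_empty_or_nonempty with he | hne
  · exact ⟨1, one_pos, fun t _ => by simp [he]⟩
  · have hbdd : BddAbove (C ∩ Set.Icc 0 (rateZero ν h lam)) := ⟨_, fun _ hx => hx.2.2⟩
    obtain ⟨haC, ha0, hax⟩ := (hC.inter isClosed_Icc).csSup_mem hne hbdd
    set a := sSup (C ∩ Set.Icc 0 (rateZero ν h lam))
    have ha : a < rateZero ν h lam := lt_of_le_of_ne hax fun he => hmem (he ▸ haC)
    -- For `ν < 1` the zero is at the origin, leaving no room for `0 ≤ a < rateZero`.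
    obtain rfl : ν = 1 := by
      by_contra hne1
      rw [rateZero, if_neg hne1] at ha
      linarith
    obtain ⟨θ, hθ, hθ0, hlt⟩ := exists_lt_of_lt_rateZero hh hlam ha0 ha hc0 (hc a haC)
    have hθl : θ < lam := by rwa [cgfDomain, if_pos rfl] at hθ
    refine ⟨Real.exp (holdingCGF 1 h lam θ), Real.exp_pos _, fun t ht => ?_⟩
    calc _ ≤ P {ω | (countingProcess T t ω).toReal / t ≤ a} :=
          measure_mono fun ω hω => le_csSup hbdd hω
      _ ≤ _ := hT.measure_left_tail_le hθ hθ0 (holdingCGF_one_nonneg hh hlam hθ0 hθl) hfin ha0 ht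
      _ ≤ _ := by gcongr

lemma limsup_closed_le
    (hT : IsRenewalSequence P T (cgfDomain ν lam) (holdingCGF ν h lam)) (hν0 : 0 < ν) (hν1 : ν ≤ 1)
    (hh : 0 < h) (hlam : 0 < lam) [IsProbabilityMeasure (holdingLaw ν h lam)]
    (hfin : ∀ᵐ ω ∂P, ∀ t : ℝ, countingProcess T t ω ≠ ⊤) {C : Set ℝ} (hC : IsClosed C) :
    limsup (fun t : ℝ => ((1 / t : ℝ) : EReal) *
      ENNReal.log (P {ω | (countingProcess T t ω).toReal / t ∈ C})) atTop
      ≤ -(⨅ x ∈ C, rateM ν h lam x) := by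
  rw [EReal.le_neg]
  refine EReal.ge_of_forall_gt_iff_ge.1 fun c hc => ?_
  rw [EReal.le_neg, ← EReal.coe_neg]
  have hcC : ∀ x ∈ C, (c : EReal) < rateM ν h lam x := fun x hx =>
    hc.trans_le (iInf₂_le x hx)
  rcases lt_or_ge c 0 with hc0 | hc0
  · refine limsup_inv_mul_log_le (K := 1) one_pos ?_
    filter_upwards [eventually_ge_atTop 0] with t ht
    refine prob_le_one.trans ?_
    rw [← ENNReal.ofReal_one, one_mul]
    refine ENNReal.ofReal_le_ofReal (Real.one_le_exp ?_)
    nlinarith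
  · have hmem : rateZero ν h lam ∉ C := fun hx => by
      have := hcC _ hx
      rw [rateM_rateZero hh hlam] at this
      exact hc0.not_gt (by exact_mod_cast this)
    obtain ⟨K, hK, hleft⟩ := hT.measure_left_part_le hh hlam hfin hC hmem hc0 hcC
    refine limsup_inv_mul_log_le (K := K + 1) (by linarith) ?_
    filter_upwards [eventually_gt_atTop 0] with t ht
    have hright := hT.measure_right_part_le hν0 hν1 hh hlam hC hmem hcC ht
    calc P {ω | (countingProcess T t ω).toReal / t ∈ C}
        ≤ P ({ω | (countingProcess T t ω).toReal / t ∈ C ∩ Set.Icc 0 (rateZero ν h lam)} ∪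
          {ω | (countingProcess T t ω).toReal / t ∈ C ∩ Set.Ici (rateZero ν h lam)}) := by
          refine measure_mono fun ω hω => ?_
          rcases le_total ((countingProcess T t ω).toReal / t) (rateZero ν h lam) with hle | hle
          · exact Or.inl ⟨hω, by positivity, hle⟩
          · exact Or.inr ⟨hω, hle⟩
      _ ≤ _ := measure_union_le _ _
      _ ≤ ENNReal.ofReal (K * Real.exp (-(c * t))) + ENNReal.ofReal (Real.exp (-(c * t))) :=
          add_le_add (hleft t ht) hright
      _ = _ := by
          rw [← ENNReal.ofReal_add (by positivity) (by positivity)]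
          ring_nf

lemma le_liminf_open
    (hT : IsRenewalSequence P T (cgfDomain ν lam) (holdingCGF ν h lam)) (hν0 : 0 < ν) (hν1 : ν ≤ 1)
    (hh : 0 < h) (hlam : 0 < lam) [IsProbabilityMeasure (holdingLaw ν h lam)]
    {G : Set ℝ} (hG : IsOpen G) :
    -(⨅ x ∈ G, rateM ν h lam x) ≤ liminf (fun t : ℝ => ((1 / t : ℝ) : EReal) *
      ENNReal.log (P {ω | (countingProcess T t ω).toReal / t ∈ G})) atTop := by
  rw [EReal.neg_le]
  have hpos : ∀ x ∈ G, 0 < x → -(liminf (fun t : ℝ => ((1 / t : ℝ) : EReal) *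
      ENNReal.log (P {ω | (countingProcess T t ω).toReal / t ∈ G})) atTop) ≤ rateM ν h lam x := by
    intro x hx hx0
    obtain ⟨θ₀, hD, hmax, -, h2⟩ := exists_maximizer hν0 hν1 hh hlam hx0
    rw [rateM_eq_of_forall_le hν0 hν1 hh hlam hx0 (mem_of_mem_nhds hD) hmax, EReal.neg_le,
      ← EReal.coe_neg]
    refine hT.neg_le_liminf_of_mem hD hx0
      (hasDerivAt_holdingCGF_of_maximizer hlam hx0 hD ?_ hmax) (hG.mem_nhds hx)
    rcases hν1.lt_or_eq with hν1 | rfl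
    · exact Or.inr (h2 hν1).1.ne
    · exact Or.inl rfl
  refine le_iInf₂ fun x hx => ?_
  rcases lt_trichotomy x 0 with hx0 | rfl | hx0
  · rw [rateM_of_neg hx0]
    exact le_top
  -- No tilt has mean `1 / 0`, so the bound is taken at points `y > 0` of `G` and passed to the
  -- limit.
  · refine ge_of_tendsto (tendsto_rateM_zero hν0 hν1 hh hlam) ?_
    filter_upwards [nhdsWithin_le_nhds (hG.mem_nhds hx), self_mem_nhdsWithin] with y hy hy0
    exact hpos y hy hy0
  · exact hpos x hx hx0

end IsRenewalSequence

end FracPoisson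

theorem mainTheorem2 {Ω : Type*} [MeasurableSpace Ω] (P : Measure Ω) [IsProbabilityMeasure P]
    (ν h lam : ℝ) (hν0 : 0 < ν) (hν1 : ν ≤ 1) (hh : 0 < h) (hlam : 0 < lam)
    (T : ℕ → Ω → ℝ) (hTmeas : ∀ n, Measurable (T n)) (hTindep : iIndepFun T P)
    (hTlaw : ∀ n, P.map (T n) = FracPoisson.holdingLaw ν h lam) :
    (∀ᵐ ω ∂P, ∀ t : ℝ, FracPoisson.countingProcess T t ω ≠ ⊤) ∧
    FracPoisson.SatisfiesLDP P
      (fun t ω => (FracPoisson.countingProcess T t ω).toReal / t) (FracPoisson.rateM ν h lam) ∧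
    FracPoisson.IsGoodRateFunction (FracPoisson.rateM ν h lam) ∧
    (ν = 1 → ∀ x : ℝ, FracPoisson.rateM ν h lam x =
      if 0 ≤ x then ((h * x * Real.log (h * x / lam) - h * x + lam : ℝ) : EReal) else ⊤) ∧
    (ν < 1 →
      (∀ x : ℝ, x < 0 → FracPoisson.rateM ν h lam x = ⊤) ∧
      StrictMonoOn (FracPoisson.rateM ν h lam) (Set.Ici 0) ∧
      Tendsto (FracPoisson.rateM ν h lam) (𝓝[>] 0) (𝓝 (FracPoisson.rateM ν h lam 0)) ∧
      FracPoisson.rateM ν h lam 0 = 0 ∧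
      Tendsto (FracPoisson.rateM ν h lam) atTop (𝓝 ⊤)) := by
  -- Total mass one is inherited from the law of `T 0`.
  have : IsProbabilityMeasure (FracPoisson.holdingLaw ν h lam) := by
    rw [← hTlaw 0]
    exact Measure.isProbabilityMeasure_map (hTmeas 0).aemeasurable
  have hT := FracPoisson.isRenewalSequence_of_map_eq_holdingLaw hν0 hh hlam hTmeas hTindep hTlaw
  have hfin := hT.ae_countingProcess_ne_top (FracPoisson.neg_mem_cgfDomain hlam neg_one_lt_zero)
    neg_one_lt_zero.le (FracPoisson.holdingCGF_neg_one_neg hh hlam)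
  have hgood := FracPoisson.isGoodRateFunction_rateM hν0 hν1 hh hlam
  refine ⟨hfin, ⟨hgood.1, fun C hC => hT.limsup_closed_le hν0 hν1 hh hlam hfin hC,
    fun G hG => hT.le_liminf_open hν0 hν1 hh hlam hG⟩, hgood, ?_, fun hν => ⟨?_, ?_, ?_, ?_, ?_⟩⟩
  · rintro rfl x
    exact FracPoisson.rateM_one hh hlam x
  · exact fun x hx => FracPoisson.rateM_of_neg hx
  · exact FracPoisson.strictMonoOn_rateM hν0 hν hh hlam
  · exact FracPoisson.tendsto_rateM_zero hν0 hν1 hh hlam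
  · rw [FracPoisson.rateM_zero, if_neg hν.ne]
  · exact FracPoisson.tendsto_rateM_atTop hν0 hh hlam
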